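/- **Notation.** Let $n\ge 4$ and let $(D_n,S)$ be a Coxeter system of type $D_n$, with generators $S=\{s_0,s_1,\dots,s_{n-1}\}$ numbered so that the edges of the Coxeter graph (all with label $3$) are $s_0 - s_2$ and $s_i - s_{i+1}$ for $1\le i\le n-2$. Let $\ell$ be the length function, $e$ the identity and $\le$ the Bruhat order (the reflexive and transitive closure of the relations $u\to ut$ with $t$ a reflection and $\ell(u)<\ell(ut)$). For $I\subseteq J\subseteq S$ let $(D_n)_J$ be the subgroup generated by $J$ and ${}^{I}(D_n)_J=\{w\in (D_n)_J : \ell(sw)>\ell(w)\ \text{for all } s\in I\}$. For $1\le i\le n-1$ put $$X_i={}^{\{s_1,\dots,s_{i-1}\}}(D_n)_{\{s_1,\dots,s_i\}}\ \cup\ \{\,s_is_{i-1}\cdots s_3\,s_0s_2s_1\cdot s_3s_4\cdots s_k : 2\le k\le i\,\}$$ (a product $s_i\cdots s_3$ with $i=2$, or $s_3\cdots s_k$ with $k=2$, is empty; for $i=1$ the second set is empty, so $X_1=\{e,s_1\}$), and $$Y_n=\{e,\ s_0,\ s_0s_2,\ s_0s_2s_3,\ \dots,\ s_0s_2s_3\cdots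 s_{n-1}\}.$$ A family $e_1,\dots,e_r$ of positive integers is the family of exponents of a finite Coxeter system $(W,S)$ if $r=|S|$ and $\sum_{w\in W}q^{\ell(w)}=\prod_{i=1}^r(1+q+\dots+q^{e_i})$. A Lehmer code for $(W,S)$ is a bijection $L:W\to\prod_{i=1}^r\{0,1,\dots,e_i\}$, where $e_1,\dots,e_r$ are the exponents, such that $L^{-1}$ is order preserving from the componentwise order to the Bruhat order on $W$. **Theorem.** Let $n\ge 4$. 1. The sets $X_1,\dots,X_{n-1}$ and $Y_n$ are saturated chains of the Bruhat order of $D_n$. 2. Every $w\in D_n$ can be written uniquely as $w=x_1x_2\cdots x_{n-1}y$ with $x_i\in X_i$ for $1\le i\le n-1$ and $y\in Y_n$; in particular $D_n=X_1X_2\cdots X_{n-1}Y_n$. 3. $D_n$ is finite with exponents $1,3,\dots,2n-3$ and $n-1$, and the function $$L_{D_n}:D_n\to\Big(\prod_{i=1}^{n-1}\{0,\dots,2i-1\}\Big)\times\{0,\dots,n-1\},\qquad L_{D_n}(w)=(\ell(x_1),\dots,\ell(x_{n-1}),\ell(y)),$$ where $w=x_1\cdots x_{n-1}y$ is the factorization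 in 2, is a Lehmer code for $D_n$. -/

import Mathlib

namespace CoxeterSystem

section General

open Polynomial

variable {B W : Type*} [Group W] {M : CoxeterMatrix B} (cs : CoxeterSystem M W)

/-- One step of the Bruhat order: `v = u t` for a reflection `t`, and `ℓ(u) < ℓ(v)`. -/
def BruhatStep (u v : W) : Prop :=
  ∃ t : W, cs.IsReflection t ∧ v = u * t ∧ cs.length u < cs.length v

/-- The Bruhat order: the reflexive and transitive closure of `BruhatStep`. -/
def BruhatLE (u v : W) : Prop := Relation.ReflTransGen cs.BruhatStep u v

/-- The strict Bruhat order. -/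
def BruhatLT (u v : W) : Prop := cs.BruhatLE u v ∧ u ≠ v

/-- `v` covers `u` in the Bruhat order of the whole group. -/
def BruhatCovBy (u v : W) : Prop :=
  cs.BruhatLT u v ∧ ∀ z : W, ¬ (cs.BruhatLT u z ∧ cs.BruhatLT z v)

/-- A (finite) saturated chain of the Bruhat order: a finite totally ordered set of elements in which
any two consecutive elements form a covering relation of the whole group. -/
structure IsSaturatedChain (C : Set W) : Prop where
  finite : C.Finite
  chain : IsChain cs.BruhatLE C
  saturated : ∀ u ∈ C, ∀ v ∈ C, cs.BruhatLT u v →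
    (∀ z ∈ C, ¬ (cs.BruhatLT u z ∧ cs.BruhatLT z v)) → cs.BruhatCovBy u v

/-- The parabolic subgroup `W_J`. -/
def parabolic (J : Set B) : Subgroup W := Subgroup.closure (cs.simple '' J)

/-- The quotient `^I W_J = {w ∈ W_J : ℓ(s w) > ℓ(w) for all s ∈ I}`. -/
def leftQuotient (I J : Set B) : Set W :=
  {w | w ∈ cs.parabolic J ∧ ∀ i ∈ I, cs.length w < cs.length (cs.simple i * w)}

/-- The family `e` is the family of exponents of the finite Coxeter system: `|S|` positive integers
with `∑_{w ∈ W} q^{ℓ(w)} = ∏ᵢ (1 + q + ⋯ + q^{eᵢ})`. -/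
structure IsExponents {ι : Type*} [Fintype ι] (e : ι → ℕ) : Prop where
  finite : Finite W
  card : Nat.card ι = Nat.card B
  pos : ∀ i, 0 < e i
  poincare : ∑ᶠ w : W, (X : ℕ[X]) ^ cs.length w = ∏ i, ∑ j ∈ Finset.range (e i + 1), X ^ j

/-- `L` is a Lehmer code with values in `∏ᵢ {0, …, eᵢ}` (the set `Set.Iic e`): the `eᵢ` are the
exponents, `L` is a bijection of `W` onto this product, and its inverse is order preserving from
the componentwise order to the Bruhat order. -/
structure IsLehmerCode {ι : Type*} [Fintype ι] (e : ι → ℕ) (L : W → ι → ℕ) : Prop where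
  exponents : cs.IsExponents e
  bijOn : Set.BijOn L Set.univ (Set.Iic e)
  inv_monotone : ∀ u v : W, L u ≤ L v → cs.BruhatLE u v

end General

end CoxeterSystem

/-- The Coxeter matrix of type `D_n` (`n ≥ 4`) on the generators `s_0, s_1, …, s_{n-1}`; the edges of
the Coxeter graph are `s_0 — s_2` and `s_i — s_{i+1}` for `1 ≤ i ≤ n - 2`. -/
def coxeterMatrixD (n : ℕ) : CoxeterMatrix (Fin n) where
  M := Matrix.of fun i j : Fin n ↦
    if i = j then 1
    else if ((i : ℕ) = 0 ∧ (j : ℕ) = 2) ∨ ((j : ℕ) = 0 ∧ (i : ℕ) = 2) ∨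
        (1 ≤ (i : ℕ) ∧ (i : ℕ) + 1 = j) ∨ (1 ≤ (j : ℕ) ∧ (j : ℕ) + 1 = i) then 3
    else 2
  isSymm := by
    ext i j
    simp only [Matrix.transpose_apply, Matrix.of_apply]
    grind
  diagonal := by simp
  off_diagonal := by
    intro i j h
    simp only [Matrix.of_apply]
    grind

namespace TypeD

variable {n : ℕ} {W : Type*} [Group W] (cs : CoxeterSystem (coxeterMatrixD n) W)

/-- The generator `s_k`; it is used only for `k < n`. -/
def gen (k : ℕ) : W := if h : k < n then cs.simple ⟨k, h⟩ else 1

/-- The product `s_a s_{a+1} ⋯ s_b` (equal to `e` if `b < a`). -/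
def up (a b : ℕ) : W := ((List.range' a (b + 1 - a)).map (gen cs)).prod

/-- The product `s_b s_{b-1} ⋯ s_a` (equal to `e` if `b < a`). -/
def down (b a : ℕ) : W := ((List.range' a (b + 1 - a)).reverse.map (gen cs)).prod

/-- The chain `X_i`, for `1 ≤ i ≤ n - 1`: the quotient `^{s_1,…,s_{i-1}} (D_n)_{s_1,…,s_i}` together
with the elements `s_i ⋯ s_3 s_0 s_2 s_1 · s_3 s_4 ⋯ s_k`, `2 ≤ k ≤ i` (there are none if `i = 1`). -/
def chainX (i : ℕ) : Set W :=
  cs.leftQuotient {j : Fin n | 1 ≤ (j : ℕ) ∧ (j : ℕ) ≤ i - 1} {j : Fin n | 1 ≤ (j : ℕ) ∧ (j : ℕ) ≤ i} ∪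
  {w | ∃ k, 2 ≤ k ∧ k ≤ i ∧ w = down cs i 3 * gen cs 0 * gen cs 2 * gen cs 1 * up cs 3 k}

/-- The chain `Y_n = {e} ∪ {s_0 s_2 s_3 ⋯ s_k : 1 ≤ k ≤ n - 1}` (for `k = 1` the element is `s_0`). -/
def chainY : Set W :=
  {1} ∪ {w | ∃ k, 1 ≤ k ∧ k ≤ n - 1 ∧ w = gen cs 0 * up cs 2 k}

/-- `w = x_1 ⋯ x_{n-1} y` with `x_i ∈ X_i` and `y ∈ Y_n`; here `x i` stands for `x_{i+1}`. -/
structure IsFactorization (w : W) (x : Fin (n - 1) → W) (y : W) : Prop where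
  mem_X : ∀ i : Fin (n - 1), x i ∈ chainX cs ((i : ℕ) + 1)
  mem_Y : y ∈ chainY cs
  prod_eq : (List.ofFn x).prod * y = w

/-- The exponents `1, 3, …, 2n - 3` and `n - 1` of `D_n`; the index `Sum.inl i` is the factor with
number `i + 1`, and `Sum.inr ()` is the last factor. -/
def exponents (n : ℕ) : Fin (n - 1) ⊕ Unit → ℕ :=
  Sum.elim (fun i ↦ 2 * ((i : ℕ) + 1) - 1) (fun _ ↦ n - 1)

/-- The tuple `(ℓ(x_1), …, ℓ(x_{n-1}), ℓ(y))`. -/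
noncomputable def lengths (x : Fin (n - 1) → W) (y : W) : Fin (n - 1) ⊕ Unit → ℕ :=
  Sum.elim (fun i ↦ cs.length (x i)) (fun _ ↦ cs.length y)

end TypeD

namespace TypeD

variable {n : ℕ} {W : Type*} [Group W] (cs : CoxeterSystem (coxeterMatrixD n) W)

/-! The factorization is built up along the subgroups `⟨s_0, …, s_m⟩`. The exchange identity
`xElt_mul_yElt` rewrites `x_m y` as `y' z`, where `y'` is a chain element one rank lower and `z =
zElt m e`; the map `(a, b) ↦ (b', e)` is a bijection of index sets preserving total length. Hence
`x_1 ⋯ x_m y = (x_1 ⋯ x_{m-1} y') z`, a smaller product times a coset representative.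

Existence: multiplying `z` by a generator on the right gives another representative, or pushes a
generator of smaller index out on the left (`zElt_mul_gen_cases`). By induction the products are
closed under right multiplication by generators, and the sum of the indices grows by at most one, so
every `w` has a code of sum at most `ℓ(w)`.

Uniqueness: `D_n` acts on `ℤ` by signed permutations. The factor in front of `z` fixes `m + 1`, and
the image of `m + 1` under `z` determines `e`; then `z` is cancelled and the induction continues.

Together these show that `ℓ(w)` equals the sum of the code (`length_prodX_mul_yElt`), which gives
the Poincaré polynomial. Raising one entry of a code by one inserts one generator into a word and
raises the length by one, so it is a Bruhat step; this gives monotonicity and the saturated chains.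
-/

/-! ### Commutation and braid relations. -/

theorem coxeterMatrixD_apply (i j : Fin n) : coxeterMatrixD n i j =
    if i = j then 1
    else if ((i : ℕ) = 0 ∧ (j : ℕ) = 2) ∨ ((j : ℕ) = 0 ∧ (i : ℕ) = 2) ∨
        (1 ≤ (i : ℕ) ∧ (i : ℕ) + 1 = j) ∨ (1 ≤ (j : ℕ) ∧ (j : ℕ) + 1 = i) then 3
    else 2 := rfl

theorem mul_mul_congr {G : Type*} [Group G] {a b c d : G} (h : a * b = c * d) (x : G) :
    x * a * b = x * c * d := by
  rw [mul_assoc, h, mul_assoc]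

theorem gen_mul_self (k : ℕ) : gen cs k * gen cs k = 1 := by
  unfold gen; split_ifs <;> simp

theorem mul_gen_mul_gen (w : W) (k : ℕ) : w * gen cs k * gen cs k = w := by
  rw [mul_assoc, gen_mul_self, mul_one]

theorem gen_comm_of_matrix {i j : ℕ}
    (h : ∀ (hi : i < n) (hj : j < n), coxeterMatrixD n ⟨i, hi⟩ ⟨j, hj⟩ = 2) :
    gen cs i * gen cs j = gen cs j * gen cs i := by
  unfold gen
  split_ifs with hi hj
  · have := cs.simple_mul_simple_pow ⟨i, hi⟩ ⟨j, hj⟩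
    rw [h hi hj, pow_two, mul_eq_one_iff_eq_inv, mul_inv_rev, cs.inv_simple, cs.inv_simple] at this
    exact this
  all_goals simp

theorem gen_braid_of_matrix {i j : ℕ} (hi : i < n) (hj : j < n)
    (h : coxeterMatrixD n ⟨i, hi⟩ ⟨j, hj⟩ = 3) :
    gen cs i * gen cs j * gen cs i = gen cs j * gen cs i * gen cs j := by
  have h3 := cs.simple_mul_simple_pow ⟨i, hi⟩ ⟨j, hj⟩
  simp only [gen, hi, hj, dif_pos]
  rw [h, pow_succ, pow_two] at h3
  have : cs.simple ⟨i, hi⟩ * cs.simple ⟨j, hj⟩ * cs.simple ⟨i, hi⟩ *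
      (cs.simple ⟨j, hj⟩ * cs.simple ⟨i, hi⟩ * cs.simple ⟨j, hj⟩) = 1 := by
    rw [← h3]; simp only [mul_assoc]
  rw [mul_eq_one_iff_eq_inv] at this
  simpa [mul_assoc] using this

/-- Commutation of the generators of the branch `s_1, s_2, …`. -/
theorem gen_comm {i j : ℕ} (hi : 1 ≤ i) (hij : i + 2 ≤ j) :
    gen cs i * gen cs j = gen cs j * gen cs i := by
  refine gen_comm_of_matrix cs fun h1 h2 ↦ ?_
  rw [coxeterMatrixD_apply]
  grind

theorem gen_zero_comm {j : ℕ} (hj : j = 1 ∨ 3 ≤ j) :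
    gen cs 0 * gen cs j = gen cs j * gen cs 0 := by
  refine gen_comm_of_matrix cs fun h1 h2 ↦ ?_
  rw [coxeterMatrixD_apply]
  grind

theorem gen_braid {i : ℕ} (hi : 1 ≤ i) (hn : i + 1 < n) :
    gen cs i * gen cs (i + 1) * gen cs i = gen cs (i + 1) * gen cs i * gen cs (i + 1) := by
  refine gen_braid_of_matrix cs (by omega) hn ?_
  rw [coxeterMatrixD_apply]
  grind

theorem gen_zero_braid (hn : 2 < n) :
    gen cs 0 * gen cs 2 * gen cs 0 = gen cs 2 * gen cs 0 * gen cs 2 := by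
  refine gen_braid_of_matrix cs (by omega) hn ?_
  simp [coxeterMatrixD]

/-! ### The words making up the chains, and moving generators through them. -/

/-- The descending word `s_m s_{m-1} ⋯` with `a` letters. -/
def desc (m : ℕ) : ℕ → W
  | 0 => 1
  | a + 1 => desc m a * gen cs (m - a)

/-- The element of length `b` in the chain `Y`: `s_0 s_2 s_3 ⋯ s_b`. -/
def yElt : ℕ → W
  | 0 => 1
  | b + 1 => yElt b * gen cs (if b = 0 then 0 else b + 1)

/-- The element of length `a` in the chain `X_m`. -/
def xElt (m a : ℕ) : W := if a < m then desc cs m a else yElt cs (a - m) * desc cs m m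

/-- Representatives of the right cosets of `⟨s_0, …, s_{m-1}⟩` in `⟨s_0, …, s_m⟩`. -/
def zElt (m e : ℕ) : W :=
  if e < m then desc cs m e
  else if e = m then desc cs m (m - 1) * gen cs 0
  else desc cs m m * yElt cs (e - m - 1)

/-- The length of `zElt cs m e`. -/
def zLen (m e : ℕ) : ℕ := if e ≤ m then e else e - 1

theorem desc_mul_gen {m a k : ℕ} (hk : 1 ≤ k) (h : k + a < m) :
    desc cs m a * gen cs k = gen cs k * desc cs m a := by
  induction a with
  | zero => simp [desc]
  | succ a ih =>
    rw [desc, mul_mul_congr (gen_comm cs hk (by omega)).symm, ih (by omega), mul_assoc]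

theorem desc_mul_gen_zero {m a : ℕ} (h : a + 2 ≤ m) :
    desc cs m a * gen cs 0 = gen cs 0 * desc cs m a := by
  induction a with
  | zero => simp [desc]
  | succ a ih =>
    rw [desc, mul_mul_congr (gen_zero_comm cs (by omega)).symm, ih (by omega), mul_assoc]

/-- The word contains `s_{k+1} s_k`. The new letter commutes with everything after this pair, is
braided with it, and emerges as `s_k`, which commutes with everything before it. -/
theorem desc_mul_gen_shift {m a k : ℕ} (hm : m < n) (ha : a ≤ m) (hk : k + 1 ≤ m)
    (h : m + 1 ≤ k + a) :
    desc cs m a * gen cs (k + 1) = gen cs k * desc cs m a := by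
  induction a with
  | zero => omega
  | succ a ih =>
    by_cases hka : m + 1 ≤ k + a
    · rw [desc, mul_mul_congr (gen_comm cs (by omega) (by omega)), ih (by omega) hka, mul_assoc]
    · obtain ⟨a, rfl⟩ : ∃ c, a = c + 1 := ⟨a - 1, by omega⟩
      have e1 : m - (a + 1) = k := by omega
      have e2 : m - a = k + 1 := by omega
      have hb := gen_braid cs (i := k) (by omega) (by omega)
      simp only [desc, e1, e2]
      rw [mul_assoc, mul_assoc, ← mul_assoc (gen cs (k + 1)), ← hb, ← mul_assoc, ← mul_assoc,
        desc_mul_gen cs (by omega) (by omega)]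
      simp only [mul_assoc]

theorem yElt_succ {b : ℕ} (hb : 1 ≤ b) : yElt cs (b + 1) = yElt cs b * gen cs (b + 1) := by
  rw [yElt, if_neg (by omega)]

theorem yElt_one : yElt cs 1 = gen cs 0 := by simp [yElt]

theorem yElt_mul_gen {b k : ℕ} (h : b + 2 ≤ k) :
    yElt cs b * gen cs k = gen cs k * yElt cs b := by
  induction b with
  | zero => simp [yElt]
  | succ b ih =>
    rcases b with _ | b
    · simpa [yElt] using gen_zero_comm cs (Or.inr h)
    · rw [yElt_succ cs (by omega), mul_mul_congr (gen_comm cs (by omega) (by omega)), ih (by omega),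
        mul_assoc]

theorem yElt_mul_gen_shift {b k : ℕ} (hb : b < n) (hk : 2 ≤ k) (h : k < b) :
    yElt cs b * gen cs k = gen cs (k + 1) * yElt cs b := by
  induction b with
  | zero => omega
  | succ b ih =>
    rw [yElt_succ cs (by omega)]
    by_cases hkb : k < b
    · rw [mul_mul_congr (gen_comm cs (by omega) (by omega)).symm, ih (by omega) hkb, mul_assoc]
    · obtain rfl : k = b := by omega
      obtain ⟨k, rfl⟩ : ∃ c, k = c + 1 := ⟨k - 1, by omega⟩
      have hb := gen_braid cs (i := k + 1) (by omega) (by omega)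
      rw [yElt_succ cs (by omega), mul_assoc, mul_assoc, ← mul_assoc (gen cs (k + 1)), hb,
        ← mul_assoc, ← mul_assoc, yElt_mul_gen cs (by omega)]
      simp only [mul_assoc]

theorem yElt_mul_gen_zero {b : ℕ} (hb : b < n) (h : 2 ≤ b) :
    yElt cs b * gen cs 0 = gen cs 2 * yElt cs b := by
  induction b, h using Nat.le_induction with
  | base => simpa [yElt, mul_assoc] using gen_zero_braid cs hb
  | succ b h ih =>
    rw [yElt_succ cs (by omega), mul_mul_congr (gen_zero_comm cs (by omega)).symm, ih (by omega),
      mul_assoc]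

theorem desc_pred_mul_gen_zero_mul_gen_two {m : ℕ} (hm : m < n) (h : 2 ≤ m) :
    desc cs m (m - 1) * gen cs 0 * gen cs 2 = gen cs 0 * (desc cs m (m - 1) * gen cs 0) := by
  obtain ⟨m, rfl⟩ : ∃ c, m = c + 2 := ⟨m - 2, by omega⟩
  have e : m + 2 - m = 2 := by omega
  have hb := gen_zero_braid cs (by omega)
  rw [show m + 2 - 1 = m + 1 by omega]
  simp only [desc, e]
  rw [mul_assoc, mul_assoc, ← mul_assoc (gen cs 2), ← hb, ← mul_assoc, ← mul_assoc,
    desc_mul_gen_zero cs (by omega)]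
  simp only [mul_assoc]

/-- Conjugation by `s_2 s_1 s_0 s_2` interchanges `s_0` and `s_1`: the two ends of the fork are
swapped once the word has passed through both. -/
theorem desc_mul_yElt_mul_gen_one {m b : ℕ} (hm : m < n) (hb : 2 ≤ b) (hbm : b ≤ m) :
    desc cs m m * yElt cs b * gen cs 1 = gen cs 0 * (desc cs m m * yElt cs b) := by
  induction b, hb using Nat.le_induction with
  | base =>
    obtain ⟨m, rfl⟩ : ∃ c, m = c + 2 := ⟨m - 2, by omega⟩
    have e : m + 2 - m = 2 := by omega
    have e' : m + 2 - (m + 1) = 1 := by omega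
    have h02 := gen_zero_braid cs (by omega)
    have h12 := gen_braid cs (i := 1) le_rfl (by omega)
    have h01 := gen_zero_comm cs (j := 1) (by omega)
    have hd := desc_mul_gen_zero cs (m := m + 2) (a := m) (by omega)
    simp only [desc, e, e', yElt, if_pos, one_mul, one_ne_zero, if_false, Nat.reduceAdd] at *
    generalize gen cs 0 = s0 at *
    generalize gen cs 1 = s1 at *
    generalize gen cs 2 = s2 at *
    generalize desc cs (m + 2) m = d at *
    calc d * s2 * s1 * (s0 * s2) * s1 = d * s2 * (s1 * s0) * s2 * s1 := by simp only [mul_assoc]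
      _ = d * s2 * s0 * (s1 * s2 * s1) := by rw [← h01]; simp only [mul_assoc]
      _ = d * (s2 * s0 * s2) * s1 * s2 := by rw [h12]; simp only [mul_assoc]
      _ = d * s0 * s2 * (s0 * s1) * s2 := by rw [← h02]; simp only [mul_assoc]
      _ = s0 * (d * s2 * s1 * (s0 * s2)) := by rw [hd, h01]; simp only [mul_assoc]
  | succ b hb ih =>
    rw [yElt_succ cs (by omega), ← mul_assoc, mul_mul_congr (gen_comm cs le_rfl (by omega)).symm,
      ih (by omega)]
    simp only [mul_assoc]

/-! ### The exchange identity. -/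

theorem desc_mul_yElt_comm {m a b : ℕ} (h : a + b + 1 ≤ m) :
    desc cs m a * yElt cs b = yElt cs b * desc cs m a := by
  induction b with
  | zero => simp [yElt]
  | succ b ih =>
    rw [yElt, ← mul_assoc, ih (by omega)]
    split_ifs with hb
    · rw [mul_mul_congr (desc_mul_gen_zero cs (by omega))]
    · rw [mul_mul_congr (desc_mul_gen cs (by omega) (by omega))]

/-- The last letter of `yElt (c + 2)` passes through `z` and becomes the last letter of `yElt (c +
1)`, which is `s_0` when `c = 0`. -/
theorem zElt_mul_gen_shift {m e c : ℕ} (hm : m < n) (he : e ≤ m) (hc : c + 2 ≤ m)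
    (h : m ≤ e + c) :
    zElt cs m e * gen cs (c + 2) = gen cs (if c = 0 then 0 else c + 1) * zElt cs m e := by
  unfold zElt
  split_ifs with h1 h2 h3 h4 <;> try omega
  · exact desc_mul_gen_shift cs hm he (by omega) (by omega)
  · subst h3 h4
    exact desc_pred_mul_gen_zero_mul_gen_two cs hm (by omega)
  · rw [mul_mul_congr (gen_zero_comm cs (by omega)),
      desc_mul_gen_shift cs hm (by omega) (by omega) (by omega), mul_assoc]

/-- Exactly one letter of the `y` word is absorbed by the descending word, namely the one that
extends it. The letters before it commute to the left, and those after it pass through with their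
position in the `y` word lowered by one. -/
theorem desc_mul_yElt {m a c : ℕ} (hm : m < n) (ha : a < m) (hc : c + 1 ≤ m)
    (h : m ≤ a + c + 1) :
    desc cs m a * yElt cs (c + 1) = yElt cs c * zElt cs m (a + 1) := by
  induction c with
  | zero =>
    obtain rfl : m = a + 1 := by omega
    simp [yElt, zElt]
  | succ c ih =>
    by_cases h' : m ≤ a + c + 1
    · rw [yElt, ← mul_assoc, ih (by omega) h', if_neg (by omega), mul_assoc,
        zElt_mul_gen_shift cs hm (by omega) (by omega) (by omega), ← mul_assoc, ← yElt]
    · rw [yElt, ← mul_assoc, if_neg (by omega), desc_mul_yElt_comm cs (by omega), zElt,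
        if_pos (by omega), desc, show m - a = c + 1 + 1 by omega, mul_assoc]

/-- The indices `(b', e)` with `xElt m a * yElt b = yElt b' * zElt m e`. -/
def exchange (m a b : ℕ) : ℕ × ℕ :=
  if a < m then if a + b + 1 ≤ m then (b, a) else (b - 1, a + 1) else (a - m, m + 1 + b)

theorem xElt_mul_yElt {m a b : ℕ} (hm : m < n) (hb : b ≤ m) :
    xElt cs m a * yElt cs b =
      yElt cs (exchange m a b).1 * zElt cs m (exchange m a b).2 := by
  unfold xElt exchange
  split_ifs with h1 h2
  · rw [desc_mul_yElt_comm cs h2, zElt, if_pos h1]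
  · obtain ⟨b, rfl⟩ : ∃ c, b = c + 1 := ⟨b - 1, by omega⟩
    exact desc_mul_yElt cs hm h1 hb (by omega)
  · rw [zElt, if_neg (by omega), if_neg (by omega), mul_assoc]
    congr 3
    simp only
    omega

theorem exchange_mem {m a b : ℕ} (ha : a + 1 ≤ 2 * m) (hb : b ≤ m) :
    (exchange m a b).1 + 1 ≤ m ∧ (exchange m a b).2 ≤ 2 * m + 1 := by
  unfold exchange; split_ifs <;> simp only <;> omega

theorem exchange_length {m a b : ℕ} :
    (exchange m a b).1 + zLen m (exchange m a b).2 = a + b := by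
  unfold exchange zLen; split_ifs <;> simp only at * <;> omega

theorem exchange_injective {m a b a' b' : ℕ} (h : exchange m a b = exchange m a' b') :
    a = a' ∧ b = b' := by
  unfold exchange at h; split_ifs at h <;> simp only [Prod.mk.injEq] at h <;> omega

theorem exchange_surjective {m c e : ℕ} (hc : c + 1 ≤ m) (he : e ≤ 2 * m + 1) :
    ∃ a b, a + 1 ≤ 2 * m ∧ b ≤ m ∧ exchange m a b = (c, e) := by
  by_cases h1 : m + 1 ≤ e
  · refine ⟨c + m, e - m - 1, by omega, by omega, ?_⟩
    rw [exchange, if_neg (by omega), Prod.mk.injEq]; omega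
  · by_cases h2 : c + e + 1 ≤ m
    · refine ⟨e, c, by omega, by omega, ?_⟩
      rw [exchange, if_pos (by omega), if_pos (by omega)]
    · refine ⟨e - 1, c + 1, by omega, by omega, ?_⟩
      rw [exchange, if_pos (by omega), if_neg (by omega), Prod.mk.injEq]; omega

/-! ### Right multiplication of coset representatives by generators. -/

theorem desc_mul_gen_cases {m a k : ℕ} (hm : m < n) (ha : a ≤ m) (hk : 1 ≤ k) (hkm : k ≤ m) :
    (∃ a', a' ≤ m ∧ a' ≤ a + 1 ∧ desc cs m a * gen cs k = desc cs m a') ∨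
    (∃ k', 1 ≤ k' ∧ k' < m ∧ desc cs m a * gen cs k = gen cs k' * desc cs m a) := by
  rcases lt_trichotomy (k + a) m with h | h | h
  · exact .inr ⟨k, hk, by omega, desc_mul_gen cs hk h⟩
  · refine .inl ⟨a + 1, by omega, le_rfl, ?_⟩
    rw [desc, show m - a = k by omega]
  · rcases Nat.lt_or_ge (m + 1) (k + a) with h' | h'
    · obtain ⟨k, rfl⟩ : ∃ c, k = c + 1 := ⟨k - 1, by omega⟩
      exact .inr ⟨k, by omega, by omega, desc_mul_gen_shift cs hm ha (by omega) (by omega)⟩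
    · obtain ⟨a, rfl⟩ : ∃ c, a = c + 1 := ⟨a - 1, by omega⟩
      refine .inl ⟨a, by omega, by omega, ?_⟩
      rw [desc, show m - a = k by omega, mul_gen_mul_gen]

theorem desc_eq_zElt {m a : ℕ} (hm : 1 ≤ m) (ha : a ≤ m) :
    ∃ e, e ≤ 2 * m + 1 ∧ zLen m e = a ∧ desc cs m a = zElt cs m e := by
  rcases ha.lt_or_eq with h | rfl
  · exact ⟨a, by omega, if_pos ha, by rw [zElt, if_pos h]⟩
  -- Two representatives have length `m`: index `m` is the one ending in `s_0`, so the full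
  -- descending word has index `m + 1`.
  · refine ⟨a + 1, by omega, by unfold zLen; split_ifs <;> omega, ?_⟩
    simp [zElt, yElt]

theorem desc_mul_yElt_mul_gen_cases {m b k : ℕ} (hm : m < n) (hm1 : 1 ≤ m) (hb : b ≤ m)
    (hk : k ≤ m) :
    (∃ e', e' ≤ 2 * m + 1 ∧ zLen m e' ≤ m + b + 1 ∧
      desc cs m m * yElt cs b * gen cs k = zElt cs m e') ∨
    (2 ≤ m ∧ ∃ k', k' < m ∧
      desc cs m m * yElt cs b * gen cs k = gen cs k' * (desc cs m m * yElt cs b)) := by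
  have hz : ∀ c, zElt cs m (m + 1 + c) = desc cs m m * yElt cs c := fun c ↦ by
    rw [zElt, if_neg (by omega), if_neg (by omega)]
    congr 2; omega
  have hl : ∀ c, zLen m (m + 1 + c) = m + c := fun c ↦ by
    rw [zLen, if_neg (by omega)]; omega
  have up : ∀ k, 1 ≤ k → k < m → desc cs m m * gen cs (k + 1) = gen cs k * desc cs m m :=
    fun k h1 h2 ↦ desc_mul_gen_shift cs hm le_rfl (by omega) (by omega)
  have hmm : desc cs m m = desc cs m (m - 1) * gen cs 1 := by
    obtain ⟨m, rfl⟩ : ∃ c, m = c + 1 := ⟨m - 1, by omega⟩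
    simp [desc]
  by_cases hb0 : b = 0
  · subst hb0
    rcases Nat.eq_zero_or_pos k with rfl | hk1
    · refine .inl ⟨m + 1 + 1, by omega, (hl _).trans_le (by omega), ?_⟩
      rw [hz]; simp [yElt]
    · have hy : yElt cs 0 = 1 := rfl
      rw [hy, mul_one]
      rcases desc_mul_gen_cases cs hm le_rfl hk1 hk with ⟨a, ha, -, h⟩ | ⟨k', h1, h2, h3⟩
      · obtain ⟨e, he, he', h'⟩ := desc_eq_zElt cs hm1 ha
        exact .inl ⟨e, he, by omega, h.trans h'⟩
      · exact .inr ⟨by omega, k', h2, h3⟩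
  by_cases hb1 : b = 1
  · subst hb1
    rw [yElt_one]
    by_cases hk0 : k = 0
    · subst hk0
      refine .inl ⟨m + 1, by omega, by unfold zLen; split_ifs <;> omega, ?_⟩
      rw [mul_gen_mul_gen, ← add_zero (m + 1), hz]; simp [yElt]
    by_cases hk1 : k = 1
    · subst hk1
      refine .inl ⟨m, by omega, by unfold zLen; split_ifs <;> omega, ?_⟩
      rw [mul_mul_congr (gen_zero_comm cs (by omega)), hmm, mul_gen_mul_gen]
      simp [zElt]
    by_cases hk2 : k = 2
    · subst hk2
      refine .inl ⟨m + 1 + 2, by omega, (hl _).trans_le (by omega), ?_⟩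
      rw [hz]; simp [yElt, mul_assoc]
    · obtain ⟨k, rfl⟩ : ∃ c, k = c + 1 := ⟨k - 1, by omega⟩
      refine .inr ⟨by omega, k, by omega, ?_⟩
      rw [mul_mul_congr (gen_zero_comm cs (by omega)), up k (by omega) (by omega), mul_assoc]
  by_cases hk0 : k = 0
  · subst hk0
    refine .inr ⟨by omega, 1, by omega, ?_⟩
    rw [mul_assoc, yElt_mul_gen_zero cs (by omega) (by omega), ← mul_assoc,
      up 1 le_rfl (by omega), mul_assoc]
  by_cases hk1 : k = 1
  · subst hk1
    exact .inr ⟨by omega, 0, by omega, desc_mul_yElt_mul_gen_one cs hm (by omega) hb⟩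
  rcases Nat.lt_or_ge k b with hkb | hkb
  · refine .inr ⟨by omega, k, by omega, ?_⟩
    rw [mul_assoc, yElt_mul_gen_shift cs (by omega) (by omega) hkb, ← mul_assoc,
      up k (by omega) (by omega), mul_assoc]
  obtain ⟨b, rfl⟩ : ∃ c, b = c + 1 := ⟨b - 1, by omega⟩
  rcases hkb.eq_or_lt with rfl | hkb
  · refine .inl ⟨m + 1 + b, by omega, (hl _).trans_le (by omega), ?_⟩
    rw [hz, yElt_succ cs (by omega), ← mul_assoc, mul_gen_mul_gen]
  rcases (Nat.succ_le_of_lt hkb).eq_or_lt with rfl | hkb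
  · refine .inl ⟨m + 1 + (b + 2), by omega, (hl _).trans_le (by omega), ?_⟩
    rw [hz, yElt_succ cs (b := b + 1) (by omega), ← mul_assoc]
  · obtain ⟨k, rfl⟩ : ∃ c, k = c + 1 := ⟨k - 1, by omega⟩
    refine .inr ⟨by omega, k, by omega, ?_⟩
    rw [mul_assoc, yElt_mul_gen cs (by omega), ← mul_assoc, up k (by omega) (by omega), mul_assoc]

/-- Right multiplication of the coset representatives `zElt` by generators. -/
theorem zElt_mul_gen_cases {m e k : ℕ} (hm : m < n) (hm1 : 1 ≤ m) (he : e ≤ 2 * m + 1)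
    (hk : k ≤ m) :
    (∃ e', e' ≤ 2 * m + 1 ∧ zLen m e' ≤ zLen m e + 1 ∧ zElt cs m e * gen cs k = zElt cs m e') ∨
    -- For `m = 1` the four `zElt` represent all of `⟨s_0, s_1⟩` and the prefix is trivial, so no
    -- generator may be pushed left; `2 ≤ m` records this for the induction.
    (2 ≤ m ∧ ∃ k', k' < m ∧ zElt cs m e * gen cs k = gen cs k' * zElt cs m e) := by
  rcases lt_trichotomy e m with h | rfl | h
  · have hz : zElt cs m e = desc cs m e := if_pos h
    have hl : zLen m e = e := if_pos h.le
    rw [hz, hl]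
    rcases Nat.eq_zero_or_pos k with rfl | hk1
    · by_cases h' : e + 2 ≤ m
      · exact .inr ⟨by omega, 0, by omega, desc_mul_gen_zero cs h'⟩
      · refine .inl ⟨m, by omega, by unfold zLen; split_ifs <;> omega, ?_⟩
        rw [zElt, if_neg (lt_irrefl m), if_pos rfl, show m - 1 = e by omega]
    · rcases desc_mul_gen_cases cs hm h.le hk1 hk with ⟨a, ha, ha', h1⟩ | ⟨k', h1, h2, h3⟩
      · obtain ⟨e', he, he', h'⟩ := desc_eq_zElt cs hm1 ha
        exact .inl ⟨e', he, by omega, h1.trans h'⟩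
      · exact .inr ⟨by omega, k', h2, h3⟩
  · have hz : zElt cs e e = desc cs e (e - 1) * gen cs 0 := by simp [zElt]
    have hl : zLen e e = e := if_pos le_rfl
    rw [hz, hl]
    by_cases hk0 : k = 0
    · subst hk0
      refine .inl ⟨e - 1, by omega, by rw [zLen, if_pos (by omega)]; omega, ?_⟩
      rw [mul_gen_mul_gen, zElt, if_pos (by omega)]
    by_cases hk1 : k = 1
    · subst hk1
      refine .inl ⟨e + 2, by omega, by rw [zLen, if_neg (by omega)]; omega, ?_⟩
      rw [zElt, if_neg (by omega), if_neg (by omega), show e + 2 - e - 1 = 1 by omega, yElt_one,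
        mul_mul_congr (gen_zero_comm cs (by omega))]
      obtain ⟨e, rfl⟩ : ∃ c, e = c + 1 := ⟨e - 1, by omega⟩
      simp [desc]
    by_cases hk2 : k = 2
    · subst hk2
      exact .inr ⟨by omega, 0, by omega, desc_pred_mul_gen_zero_mul_gen_two cs hm (by omega)⟩
    · obtain ⟨k, rfl⟩ : ∃ c, k = c + 1 := ⟨k - 1, by omega⟩
      refine .inr ⟨by omega, k, by omega, ?_⟩
      rw [mul_mul_congr (gen_zero_comm cs (by omega)),
        desc_mul_gen_shift cs hm (by omega) (by omega) (by omega), mul_assoc]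
  · have hz : zElt cs m e = desc cs m m * yElt cs (e - m - 1) := by
      rw [zElt, if_neg (by omega), if_neg (by omega)]
    have hl : zLen m e = m + (e - m - 1) := by rw [zLen, if_neg (by omega)]; omega
    rw [hz, hl]
    exact desc_mul_yElt_mul_gen_cases cs hm hm1 (by omega) hk

/-! ### The signed permutation action. -/

/-- The action of `s_k` on `ℤ` in the realization of `D_n` by signed permutations. -/
def flip (k : ℕ) (x : ℤ) : ℤ :=
  if k = 0 then if x = 1 then -2 else if x = 2 then -1 else if x = -1 then 2
    else if x = -2 then 1 else x
  else if x = k then k + 1 else if x = k + 1 then k else if x = -k then -(k + 1)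
    else if x = -(k + 1) then -k else x

theorem flip_zero_cases (x : ℤ) :
    x = 1 ∧ flip 0 x = -2 ∨ x = 2 ∧ flip 0 x = -1 ∨ x = -1 ∧ flip 0 x = 2 ∨
      x = -2 ∧ flip 0 x = 1 ∨ x ≠ 1 ∧ x ≠ 2 ∧ x ≠ -1 ∧ x ≠ -2 ∧ flip 0 x = x := by
  unfold flip; simp only [if_true]; split_ifs <;> omega

theorem flip_cases {k : ℕ} (hk : 1 ≤ k) (x : ℤ) :
    x = k ∧ flip k x = k + 1 ∨ x = k + 1 ∧ flip k x = k ∨ x = -k ∧ flip k x = -(k + 1) ∨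
      x = -(k + 1) ∧ flip k x = -k ∨
      x ≠ k ∧ x ≠ k + 1 ∧ x ≠ -k ∧ x ≠ -(k + 1) ∧ flip k x = x := by
  unfold flip; rw [if_neg (by omega)]; split_ifs <;> omega

theorem flip_flip (k : ℕ) (x : ℤ) : flip k (flip k x) = x := by
  rcases Nat.eq_zero_or_pos k with rfl | hk
  · have h1 := flip_zero_cases x
    have h2 := flip_zero_cases (flip 0 x)
    omega
  · have h1 := flip_cases hk x
    have h2 := flip_cases hk (flip k x)
    omega

theorem flip_comm {i j : ℕ} (hi : 1 ≤ i) (hij : i + 2 ≤ j) (x : ℤ) :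
    flip i (flip j x) = flip j (flip i x) := by
  have h1 := flip_cases hi x
  have h2 := flip_cases (hi.trans (by omega : i ≤ j)) x
  have h3 := flip_cases hi (flip j x)
  have h4 := flip_cases (hi.trans (by omega : i ≤ j)) (flip i x)
  omega

theorem flip_zero_comm {j : ℕ} (h : j = 1 ∨ 3 ≤ j) (x : ℤ) :
    flip 0 (flip j x) = flip j (flip 0 x) := by
  have h1 := flip_zero_cases x
  have h2 := flip_cases (k := j) (by omega) x
  have h3 := flip_zero_cases (flip j x)
  have h4 := flip_cases (k := j) (by omega) (flip 0 x)
  omega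

theorem flip_zero_braid (x : ℤ) :
    flip 0 (flip 2 (flip 0 x)) = flip 2 (flip 0 (flip 2 x)) := by
  rcases flip_zero_cases x with h1 | h1 | h1 | h1 | h1 <;>
  rcases flip_cases one_le_two x with h2 | h2 | h2 | h2 | h2 <;> first | omega | skip
  all_goals
    have h3 := flip_zero_cases (flip 2 x)
    have h4 := flip_cases one_le_two (flip 0 x)
    have h5 := flip_cases one_le_two (flip 0 (flip 2 x))
    have h6 := flip_zero_cases (flip 2 (flip 0 x))
    omega

theorem flip_braid {i : ℕ} (hi : 1 ≤ i) (x : ℤ) :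
    flip i (flip (i + 1) (flip i x)) = flip (i + 1) (flip i (flip (i + 1) x)) := by
  have hj : 1 ≤ i + 1 := by omega
  rcases flip_cases hi x with h1 | h1 | h1 | h1 | h1 <;>
  rcases flip_cases hj x with h2 | h2 | h2 | h2 | h2 <;> first | omega | skip
  all_goals
    have h3 := flip_cases hi (flip (i + 1) x)
    have h4 := flip_cases hj (flip i x)
    have h5 := flip_cases hj (flip i (flip (i + 1) x))
    have h6 := flip_cases hi (flip (i + 1) (flip i x))
    push_cast at *
    omega
/-- The map `flip k` as an element of the monoid of self-maps of `ℤ`. -/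
def flipEnd (k : ℕ) : Function.End ℤ := flip k

theorem flipEnd_isLiftable (n : ℕ) :
    (coxeterMatrixD n).IsLiftable (fun k ↦ flipEnd (k : ℕ)) := by
  intro i j
  have hsq : ∀ k : ℕ, flipEnd k * flipEnd k = 1 := fun k ↦ funext (flip_flip k)
  have comm : ∀ a b : Function.End ℤ, a * a = 1 → b * b = 1 → a * b = b * a →
      (a * b) ^ 2 = 1 := fun a b ha hb h ↦ by
    rw [pow_two, mul_assoc, ← mul_assoc b, ← h, mul_assoc, hb, mul_one, ha]
  have braid : ∀ a b : Function.End ℤ, a * a = 1 → b * b = 1 → a * b * a = b * a * b →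
      (a * b) ^ 3 = 1 := fun a b ha hb h ↦ by
    rw [pow_succ, pow_two, show a * b * (a * b) * (a * b) = a * b * a * (b * a * b) by
      simp only [mul_assoc], ← h, show a * b * a * (a * b * a) = a * (b * (a * a) * b) * a by
      simp only [mul_assoc], ha, mul_one, hb, mul_one, ha]
  rw [coxeterMatrixD_apply]
  beta_reduce
  split_ifs with h1 h2
  · rw [h1, hsq, pow_one]
  · refine braid _ _ (hsq _) (hsq _) ?_
    rcases h2 with h | h | h | h
    · rw [h.1, h.2]; exact funext flip_zero_braid
    · rw [h.1, h.2]; exact (funext flip_zero_braid).symm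
    · rw [← h.2]; exact funext (flip_braid h.1)
    · rw [← h.2]; exact (funext (flip_braid h.1)).symm
  · refine comm _ _ (hsq _) (hsq _) ?_
    have h1' : (i : ℕ) ≠ j := fun h ↦ h1 (Fin.ext h)
    rcases Nat.eq_zero_or_pos (i : ℕ) with hi | hi
    · rw [hi]; exact funext (flip_zero_comm (by omega))
    rcases Nat.eq_zero_or_pos (j : ℕ) with hj | hj
    · rw [hj]; exact (funext (flip_zero_comm (by omega))).symm
    rcases lt_or_gt_of_ne h1' with h | h
    · exact funext (flip_comm hi (by omega))
    · exact (funext (flip_comm hj (by omega))).symm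

/-- The right action of `W` on `ℤ` by signed permutations. -/
def act (x : ℤ) (w : W) : ℤ := (cs.lift ⟨_, flipEnd_isLiftable n⟩ w⁻¹) x

theorem act_one (x : ℤ) : act cs x 1 = x := by
  rw [act, inv_one, map_one]; rfl

theorem act_mul (x : ℤ) (u v : W) : act cs x (u * v) = act cs (act cs x u) v := by
  rw [act, mul_inv_rev, map_mul]; rfl

theorem act_gen (x : ℤ) {k : ℕ} (hk : k < n) : act cs x (gen cs k) = flip k x := by
  rw [act, gen, dif_pos hk, cs.inv_simple, cs.lift_apply_simple (flipEnd_isLiftable n)]; rfl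

theorem act_desc_of_lt {m a : ℕ} {x : ℤ} (hm : m < n) (ha : a ≤ m) (hx : m + 1 < x) :
    act cs x (desc cs m a) = x := by
  induction a with
  | zero => exact act_one cs x
  | succ a ih =>
    rw [desc, act_mul, ih (by omega), act_gen cs _ (by omega)]
    unfold flip; grind

theorem act_yElt_of_lt {b : ℕ} {x : ℤ} (hb : b < n) (hn : 2 ≤ n) (hx : b + 1 < x) (hx2 : 2 < x) :
    act cs x (yElt cs b) = x := by
  induction b with
  | zero => exact act_one cs x
  | succ b ih =>
    rw [yElt, act_mul, ih (by omega) (by push_cast at hx; omega), act_gen cs _ (by split_ifs <;> omega)]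
    unfold flip; grind

theorem act_desc {m a : ℕ} (hm : m < n) (ha : a ≤ m) :
    act cs (m + 1) (desc cs m a) = m + 1 - a := by
  induction a with
  | zero => simp [desc, act_one]
  | succ a ih =>
    rw [desc, act_mul, ih (by omega), act_gen cs _ (by omega)]
    unfold flip; grind

theorem act_one_yElt {b : ℕ} (hb : b < n) :
    act cs 1 (yElt cs b) = if b = 0 then 1 else -(b + 1 : ℤ) := by
  induction b with
  | zero => simp [yElt, act_one]
  | succ b ih =>
    rw [yElt, act_mul, ih (by omega), act_gen cs _ (by split_ifs <;> omega)]
    unfold flip; grind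

theorem act_zElt {m e : ℕ} (hm : m < n) (hm1 : 1 ≤ m) (he : e ≤ 2 * m + 1) :
    act cs (m + 1) (zElt cs m e) =
      if e < m then (m + 1 - e : ℤ) else if e = m then -1 else if e = m + 1 then 1
      else (m - e : ℤ) := by
  unfold zElt
  split_ifs with h1 h2 h3
  · exact act_desc cs hm h1.le
  · rw [act_mul, act_desc cs hm (by omega), act_gen cs _ (by omega)]
    unfold flip; grind
  · rw [act_mul, act_desc cs hm le_rfl, add_sub_cancel_left, act_one_yElt cs (by omega),
      if_pos (by omega)]
  · rw [act_mul, act_desc cs hm le_rfl, add_sub_cancel_left, act_one_yElt cs (by omega),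
      if_neg (by omega)]
    omega

/-- The `2 m + 2` representatives send `m + 1` to the distinct values `±1, …, ±(m + 1)`. -/
theorem zElt_index_eq {m e e' : ℕ} (hm : m < n) (hm1 : 1 ≤ m) (he : e ≤ 2 * m + 1)
    (he' : e' ≤ 2 * m + 1) (h : act cs (m + 1) (zElt cs m e) = act cs (m + 1) (zElt cs m e')) :
    e = e' := by
  rw [act_zElt cs hm hm1 he, act_zElt cs hm hm1 he'] at h
  split_ifs at h <;> omega

theorem act_xElt_of_lt {m a : ℕ} {x : ℤ} (hm : m < n) (ha : a + 1 ≤ 2 * m) (hx : m + 1 < x) :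
    act cs x (xElt cs m a) = x := by
  unfold xElt
  split_ifs
  · exact act_desc_of_lt cs hm (by omega) hx
  · rw [act_mul, act_yElt_of_lt cs (by omega) (by omega) (by omega) (by omega),
      act_desc_of_lt cs hm (by omega) hx]

/-! ### Uniqueness and existence of the factorization. -/

/-- The product `x_1 ⋯ x_m`, where `x_i` is the element of length `a i` in the chain `X_i`. -/
def prodX (a : ℕ → ℕ) : ℕ → W
  | 0 => 1
  | m + 1 => prodX a m * xElt cs (m + 1) (a (m + 1))

theorem act_prodX_of_lt {m : ℕ} {a : ℕ → ℕ} {x : ℤ} (hm : m < n)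
    (ha : ∀ i, 1 ≤ i → i ≤ m → a i + 1 ≤ 2 * i) (hx : m + 1 < x) :
    act cs x (prodX cs a m) = x := by
  induction m with
  | zero => exact act_one cs x
  | succ m ih =>
    rw [prodX, act_mul, ih (by omega) (fun i h1 h2 ↦ ha i h1 (by omega)) (by push_cast at hx; omega),
      act_xElt_of_lt cs hm (ha _ (by omega) le_rfl) hx]

theorem prodX_congr {m : ℕ} {a a' : ℕ → ℕ} (h : ∀ i, 1 ≤ i → i ≤ m → a i = a' i) :
    prodX cs a m = prodX cs a' m := by
  induction m with
  | zero => rfl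
  | succ m ih => rw [prodX, prodX, ih fun i h1 h2 ↦ h i h1 (by omega), h _ (by omega) le_rfl]

/-- Uniqueness of the factorization. -/
theorem prodX_mul_yElt_injective {m : ℕ} {a a' : ℕ → ℕ} {b b' : ℕ} (hm : m < n)
    (ha : ∀ i, 1 ≤ i → i ≤ m → a i + 1 ≤ 2 * i) (ha' : ∀ i, 1 ≤ i → i ≤ m → a' i + 1 ≤ 2 * i)
    (hb : b ≤ m) (hb' : b' ≤ m)
    (h : prodX cs a m * yElt cs b = prodX cs a' m * yElt cs b') :
    (∀ i, 1 ≤ i → i ≤ m → a i = a' i) ∧ b = b' := by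
  induction m generalizing b b' with
  | zero => exact ⟨fun i h1 h2 ↦ by omega, by omega⟩
  | succ m ih =>
    have hA := ha (m + 1) (by omega) le_rfl
    have hA' := ha' (m + 1) (by omega) le_rfl
    obtain ⟨h1, h2⟩ := exchange_mem hA hb
    obtain ⟨h1', h2'⟩ := exchange_mem hA' hb'
    have ha1 : ∀ i, 1 ≤ i → i ≤ m → a i + 1 ≤ 2 * i := fun i h1 h2 ↦ ha i h1 (by omega)
    have ha1' : ∀ i, 1 ≤ i → i ≤ m → a' i + 1 ≤ 2 * i := fun i h1 h2 ↦ ha' i h1 (by omega)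
    rw [prodX, prodX, mul_assoc, mul_assoc, xElt_mul_yElt cs hm hb, xElt_mul_yElt cs hm hb',
      ← mul_assoc, ← mul_assoc] at h
    have fix : ∀ (a : ℕ → ℕ) (c : ℕ), (∀ i, 1 ≤ i → i ≤ m → a i + 1 ≤ 2 * i) → c ≤ m →
        act cs ((m + 1 : ℕ) + 1) (prodX cs a m * yElt cs c) = (m + 1 : ℕ) + 1 := by
      intro a c ha hc
      rw [act_mul, act_prodX_of_lt cs (by omega) ha (by omega)]
      rcases Nat.eq_zero_or_pos c with rfl | hc0
      · exact act_one cs _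
      · exact act_yElt_of_lt cs (by omega) (by omega) (by omega) (by omega)
    -- Both prefixes fix `m + 2`, so comparing its images compares only the `z` factors.
    have he : (exchange (m + 1) (a (m + 1)) b).2 = (exchange (m + 1) (a' (m + 1)) b').2 := by
      refine zElt_index_eq cs hm (by omega) h2 h2' ?_
      have := congrArg (act cs ((m + 1 : ℕ) + 1)) h
      rwa [act_mul, act_mul _ _ (_ * _), fix a _ ha1 (by omega), fix a' _ ha1' (by omega)] at this
    rw [he] at h
    obtain ⟨h3, h4⟩ := ih (by omega) ha1 ha1' (by omega) (by omega) (mul_right_cancel h)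
    obtain ⟨h5, h6⟩ := exchange_injective (Prod.ext h4 he)
    refine ⟨fun i hi1 hi2 ↦ ?_, h6⟩
    rcases hi2.lt_or_eq with hi | rfl
    · exact h3 i hi1 (by omega)
    · exact h5

/-- Products of the chains are closed under right multiplication by generators. -/
theorem exists_prodX_mul_yElt_mul_gen {m k : ℕ} {a : ℕ → ℕ} {b : ℕ} (hm : m < n) (hm1 : 1 ≤ m)
    (ha : ∀ i, 1 ≤ i → i ≤ m → a i + 1 ≤ 2 * i) (hb : b ≤ m) (hk : k ≤ m) :
    ∃ (a' : ℕ → ℕ) (b' : ℕ), (∀ i, 1 ≤ i → i ≤ m → a' i + 1 ≤ 2 * i) ∧ b' ≤ m ∧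
      ∑ i ∈ Finset.range m, a' (i + 1) + b' ≤ ∑ i ∈ Finset.range m, a (i + 1) + b + 1 ∧
      prodX cs a m * yElt cs b * gen cs k = prodX cs a' m * yElt cs b' := by
  induction m generalizing k b with
  | zero => omega
  | succ m ih =>
    have hA := ha (m + 1) (by omega) le_rfl
    have ha1 : ∀ i, 1 ≤ i → i ≤ m → a i + 1 ≤ 2 * i := fun i h1 h2 ↦ ha i h1 (by omega)
    obtain ⟨h1, h2⟩ := exchange_mem hA hb
    have hl := exchange_length (m := m + 1) (a := a (m + 1)) (b := b)
    -- Surjectivity of `exchange` turns a product ending in `y' z` back into one ending in `x_{m+1}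
    -- y`, with the same total length.
    have key : ∀ (a' : ℕ → ℕ) (c e : ℕ), (∀ i, 1 ≤ i → i ≤ m → a' i + 1 ≤ 2 * i) → c + 1 ≤ m + 1 →
        e ≤ 2 * (m + 1) + 1 →
        ∑ i ∈ Finset.range m, a' (i + 1) + c + zLen (m + 1) e ≤
          ∑ i ∈ Finset.range (m + 1), a (i + 1) + b + 1 →
        prodX cs a (m + 1) * yElt cs b * gen cs k =
          prodX cs a' m * yElt cs c * zElt cs (m + 1) e →
        ∃ (a' : ℕ → ℕ) (b' : ℕ), (∀ i, 1 ≤ i → i ≤ m + 1 → a' i + 1 ≤ 2 * i) ∧ b' ≤ m + 1 ∧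
          ∑ i ∈ Finset.range (m + 1), a' (i + 1) + b' ≤
            ∑ i ∈ Finset.range (m + 1), a (i + 1) + b + 1 ∧
          prodX cs a (m + 1) * yElt cs b * gen cs k = prodX cs a' (m + 1) * yElt cs b' := by
      intro a' c e ha' hc he hsum heq
      obtain ⟨A, B, hA, hB, hex⟩ := exchange_surjective hc he
      have hl' := exchange_length (m := m + 1) (a := A) (b := B)
      rw [hex] at hl'
      have hcongr : ∀ i, i ≤ m → Function.update a' (m + 1) A i = a' i := fun i hi ↦
        Function.update_of_ne (by omega) _ _
      refine ⟨Function.update a' (m + 1) A, B, fun i hi1 hi2 ↦ ?_, hB, ?_, ?_⟩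
      · rcases hi2.lt_or_eq with hi | rfl
        · rw [hcongr i (by omega)]; exact ha' i hi1 (by omega)
        · rwa [Function.update_self]
      · rw [Finset.sum_range_succ, Function.update_self, Finset.sum_congr rfl fun i hi ↦
          hcongr (i + 1) (by have := Finset.mem_range.1 hi; omega)]
        simp only at hl'
        omega
      · rw [heq, prodX, Function.update_self, prodX_congr cs fun i _ hi ↦ hcongr i hi, mul_assoc,
          mul_assoc, xElt_mul_yElt cs hm hB, hex]
    have hstart : prodX cs a (m + 1) * yElt cs b = prodX cs a m *
        yElt cs (exchange (m + 1) (a (m + 1)) b).1 *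
          zElt cs (m + 1) (exchange (m + 1) (a (m + 1)) b).2 := by
      rw [prodX, mul_assoc, xElt_mul_yElt cs hm hb, mul_assoc]
    have hs := Finset.sum_range_succ (fun i ↦ a (i + 1)) m
    rcases zElt_mul_gen_cases cs hm (by omega) h2 hk with ⟨e, he, hle, h⟩ | ⟨hm2, k', hk', h⟩
    · refine key a _ e ha1 h1 he (by omega) ?_
      rw [hstart, mul_assoc, h]
    · obtain ⟨a', c, ha', hc, hsum, h'⟩ := ih (k := k') (by omega) (by omega) ha1
        (show (exchange (m + 1) (a (m + 1)) b).1 ≤ m by omega) (by omega)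
      refine key a' c _ ha' (by omega) h2 (by omega) ?_
      rw [hstart, mul_assoc, h, ← mul_assoc, h']

/-! ### Additivity of the length. -/

theorem length_gen_le (k : ℕ) : cs.length (gen cs k) ≤ 1 := by
  unfold gen; split_ifs <;> simp

theorem length_mul_le_of_le {u v : W} {a b : ℕ} (hu : cs.length u ≤ a) (hv : cs.length v ≤ b) :
    cs.length (u * v) ≤ a + b :=
  (cs.length_mul_le u v).trans (add_le_add hu hv)

theorem length_desc_le (m a : ℕ) : cs.length (desc cs m a) ≤ a := by
  induction a with
  | zero => simp [desc]
  | succ a ih => exact length_mul_le_of_le cs ih (length_gen_le cs _)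

theorem length_yElt_le (b : ℕ) : cs.length (yElt cs b) ≤ b := by
  induction b with
  | zero => simp [yElt]
  | succ b ih => exact length_mul_le_of_le cs ih (length_gen_le cs _)

theorem length_xElt_le (m a : ℕ) : cs.length (xElt cs m a) ≤ a := by
  unfold xElt
  split_ifs with h
  · exact length_desc_le cs m a
  · exact (length_mul_le_of_le cs (length_yElt_le cs _) (length_desc_le cs m m)).trans (by omega)

theorem length_prodX_le (a : ℕ → ℕ) (m : ℕ) :
    cs.length (prodX cs a m) ≤ ∑ i ∈ Finset.range m, a (i + 1) := by
  induction m with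
  | zero => simp [prodX]
  | succ m ih =>
    rw [Finset.sum_range_succ]
    exact length_mul_le_of_le cs ih (length_xElt_le cs _ _)

/-- The bounds `a_i ≤ 2 i - 1` for `1 ≤ i ≤ n - 1` and `b ≤ n - 1` on the entries of a code. -/
def IsCode (n : ℕ) (a : ℕ → ℕ) (b : ℕ) : Prop :=
  (∀ i, 1 ≤ i → i ≤ n - 1 → a i + 1 ≤ 2 * i) ∧ b ≤ n - 1

theorem exists_code_wordProd (hn : 2 ≤ n) (ω : List (Fin n)) :
    ∃ a b, IsCode n a b ∧ ∑ i ∈ Finset.range (n - 1), a (i + 1) + b ≤ ω.length ∧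
      cs.wordProd ω = prodX cs a (n - 1) * yElt cs b := by
  induction ω using List.reverseRecOn with
  | nil =>
    refine ⟨0, 0, ⟨fun i h _ ↦ by simp; omega, by omega⟩, by simp, ?_⟩
    have : ∀ m, prodX cs 0 m = 1 := fun m ↦ by
      induction m with
      | zero => rfl
      | succ m ih => simp [prodX, ih, xElt, desc]
    simp [this, yElt]
  | append_singleton ω k ih =>
    obtain ⟨a, b, ⟨ha, hb⟩, hl, h⟩ := ih
    obtain ⟨a', b', ha', hb', hl', h'⟩ := exists_prodX_mul_yElt_mul_gen cs (k := k)
      (by omega : n - 1 < n) (by omega) ha hb (by omega)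
    refine ⟨a', b', ⟨ha', hb'⟩, ?_, ?_⟩
    · rw [List.length_append, List.length_singleton]; omega
    · rw [cs.wordProd_append, h, cs.wordProd_singleton, ← h', gen, dif_pos k.2]

theorem exists_code (hn : 2 ≤ n) (w : W) :
    ∃ a b, IsCode n a b ∧ ∑ i ∈ Finset.range (n - 1), a (i + 1) + b ≤ cs.length w ∧
      w = prodX cs a (n - 1) * yElt cs b := by
  obtain ⟨ω, h, rfl⟩ := cs.exists_isReduced w
  rw [h.eq]
  exact exists_code_wordProd cs hn ω

/-- The length is additive on the factorization. -/
theorem length_prodX_mul_yElt (hn : 2 ≤ n) {a : ℕ → ℕ} {b : ℕ} (h : IsCode n a b) :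
    cs.length (prodX cs a (n - 1) * yElt cs b) = ∑ i ∈ Finset.range (n - 1), a (i + 1) + b := by
  refine le_antisymm (length_mul_le_of_le cs (length_prodX_le cs a _) (length_yElt_le cs b)) ?_
  -- This code has sum at most the length; by uniqueness it is the given code.
  obtain ⟨a', b', h', hl, heq⟩ := exists_code cs hn (prodX cs a (n - 1) * yElt cs b)
  obtain ⟨h1, h2⟩ := prodX_mul_yElt_injective cs (by omega) h.1 h'.1 h.2 h'.2 heq
  rw [Finset.sum_congr rfl fun i hi ↦ h1 (i + 1) (by omega) (by
    have := Finset.mem_range.1 hi; omega)]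
  omega

theorem xElt_zero {m : ℕ} (hm : 1 ≤ m) : xElt cs m 0 = 1 := by
  rw [xElt, if_pos (by omega)]; rfl

theorem xElt_eq_desc {m a : ℕ} (ha : a ≤ m) : xElt cs m a = desc cs m a := by
  unfold xElt
  split_ifs with h
  · rfl
  · obtain rfl : a = m := by omega
    simp [yElt]

theorem prodX_eq_of_zero {a : ℕ → ℕ} {j m : ℕ} (hjm : j ≤ m)
    (h : ∀ k, j < k → k ≤ m → a k = 0) : prodX cs a m = prodX cs a j := by
  induction m, hjm using Nat.le_induction with
  | base => rfl
  | succ m hm ih =>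
    rw [prodX, h _ (by omega) le_rfl, xElt_zero cs (by omega), mul_one,
      ih fun k h1 h2 ↦ h k h1 (by omega)]

theorem prodX_eq_xElt {a : ℕ → ℕ} {j m : ℕ} (hj : 1 ≤ j) (hjm : j ≤ m)
    (h : ∀ k, 1 ≤ k → k ≤ m → k ≠ j → a k = 0) : prodX cs a m = xElt cs j (a j) := by
  rw [prodX_eq_of_zero cs hjm fun k h1 h2 ↦ h k (by omega) h2 (by omega)]
  obtain ⟨j, rfl⟩ : ∃ c, j = c + 1 := ⟨j - 1, by omega⟩
  rw [prodX, prodX_eq_of_zero cs (Nat.zero_le j) fun k h1 h2 ↦ h k h1 (by omega) (by omega), prodX,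
    one_mul]

theorem prodX_single {i m : ℕ} (a : ℕ) (hi : 1 ≤ i) (him : i ≤ m) :
    prodX cs (Pi.single i a) m = xElt cs i a := by
  rw [prodX_eq_xElt cs hi him fun k _ _ h ↦ by rw [Pi.single_eq_of_ne h], Pi.single_eq_same]

theorem sum_single_range {i m : ℕ} (a : ℕ) (hi : 1 ≤ i) (him : i ≤ m) :
    ∑ k ∈ Finset.range m, (Pi.single i a : ℕ → ℕ) (k + 1) = a := by
  rw [Finset.sum_eq_single (i - 1)]
  · rw [show i - 1 + 1 = i by omega, Pi.single_eq_same]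
  · exact fun k _ hk ↦ by rw [Pi.single_eq_of_ne (by omega)]
  · exact fun h ↦ absurd (Finset.mem_range.2 (by omega)) h

theorem isCode_single {i a : ℕ} (ha : a + 1 ≤ 2 * i) : IsCode n (Pi.single i a) 0 := by
  refine ⟨fun k hk _ ↦ ?_, Nat.zero_le _⟩
  by_cases h : k = i
  · subst h; rwa [Pi.single_eq_same]
  · rw [Pi.single_eq_of_ne h]; omega

theorem length_xElt {i a : ℕ} (hi : 1 ≤ i) (hin : i < n) (ha : a + 1 ≤ 2 * i) :
    cs.length (xElt cs i a) = a := by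
  have := length_prodX_mul_yElt cs (by omega) (isCode_single (n := n) ha)
  rwa [prodX_single cs a hi (by omega), sum_single_range a hi (by omega), yElt, mul_one,
    add_zero] at this

theorem prodX_zero (m : ℕ) : prodX cs 0 m = 1 :=
  prodX_eq_of_zero cs (Nat.zero_le m) fun _ _ _ ↦ rfl

theorem isCode_zero {b : ℕ} (hb : b ≤ n - 1) : IsCode n 0 b :=
  ⟨fun k hk _ ↦ by rw [Pi.zero_apply]; omega, hb⟩

theorem length_yElt (hn : 2 ≤ n) {b : ℕ} (hb : b ≤ n - 1) : cs.length (yElt cs b) = b := by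
  have := length_prodX_mul_yElt cs hn (isCode_zero hb)
  simpa [prodX_zero] using this

/-! ### Monotonicity for the Bruhat order. -/

/-- The element `v` arises from `u` by inserting a generator into an expression for `u`. -/
def IsInsertion (u v : W) : Prop :=
  ∃ A B k, k < n ∧ u = A * B ∧ v = A * gen cs k * B

variable {cs} in
theorem IsInsertion.mul_left {u v : W} (h : IsInsertion cs u v) (w : W) :
    IsInsertion cs (w * u) (w * v) := by
  obtain ⟨A, B, k, hk, rfl, rfl⟩ := h
  exact ⟨w * A, B, k, hk, by simp only [mul_assoc], by simp only [mul_assoc]⟩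

variable {cs} in
theorem IsInsertion.mul_right {u v : W} (h : IsInsertion cs u v) (w : W) :
    IsInsertion cs (u * w) (v * w) := by
  obtain ⟨A, B, k, hk, rfl, rfl⟩ := h
  exact ⟨A, B * w, k, hk, by simp only [mul_assoc], by simp only [mul_assoc]⟩

variable {cs} in
theorem IsInsertion.bruhatStep {u v : W} (h : IsInsertion cs u v)
    (hl : cs.length u < cs.length v) : cs.BruhatStep u v := by
  obtain ⟨A, B, k, hk, rfl, rfl⟩ := h
  -- `A s B = (A B)(B⁻¹ s B)`.
  refine ⟨B⁻¹ * gen cs k * B, ⟨B⁻¹, ⟨k, hk⟩, ?_⟩, by group, hl⟩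
  rw [gen, dif_pos hk, inv_inv]

theorem isInsertion_yElt {b : ℕ} (hb : b + 1 < n) :
    IsInsertion cs (yElt cs b) (yElt cs (b + 1)) :=
  ⟨yElt cs b, 1, _, by split_ifs <;> omega, (mul_one _).symm, (mul_one _).symm⟩

theorem isInsertion_xElt {m a : ℕ} (hm : m < n) (ha : a + 2 ≤ 2 * m) :
    IsInsertion cs (xElt cs m a) (xElt cs m (a + 1)) := by
  by_cases h : a + 1 ≤ m
  · rw [xElt_eq_desc cs h, xElt_eq_desc cs (by omega)]
    exact ⟨desc cs m a, 1, m - a, by omega, (mul_one _).symm, (mul_one _).symm⟩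
  · rw [xElt, xElt, if_neg (by omega), if_neg (by omega), show a + 1 - m = a - m + 1 by omega]
    exact (isInsertion_yElt cs (by omega)).mul_right _

theorem isInsertion_prodX {m i : ℕ} {a : ℕ → ℕ} (hm : m < n) (hi : 1 ≤ i) (him : i ≤ m)
    (ha : a i + 2 ≤ 2 * i) :
    IsInsertion cs (prodX cs a m) (prodX cs (Function.update a i (a i + 1)) m) := by
  induction m, him using Nat.le_induction with
  | base =>
    obtain ⟨i, rfl⟩ : ∃ c, i = c + 1 := ⟨i - 1, by omega⟩
    have hcongr : ∀ k, 1 ≤ k → k ≤ i → Function.update a (i + 1) (a (i + 1) + 1) k = a k :=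
      fun k _ h ↦ Function.update_of_ne (by omega) _ _
    rw [prodX, prodX, Function.update_self, prodX_congr cs hcongr]
    exact (isInsertion_xElt cs hm ha).mul_left _
  | succ m hm' ih =>
    rw [prodX, prodX, Function.update_of_ne (by omega)]
    exact (ih (by omega)).mul_right _

theorem sum_update_succ {m i : ℕ} (a : ℕ → ℕ) (hi : 1 ≤ i) (him : i ≤ m) :
    ∑ k ∈ Finset.range m, Function.update a i (a i + 1) (k + 1) =
      ∑ k ∈ Finset.range m, a (k + 1) + 1 := by
  have : ∀ k, Function.update a i (a i + 1) k = a k + (Pi.single i 1 : ℕ → ℕ) k := fun k ↦ by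
    by_cases h : k = i
    · subst h; simp
    · simp [h]
  rw [Finset.sum_congr rfl fun k _ ↦ this (k + 1), Finset.sum_add_distrib,
    sum_single_range 1 hi him]

/-- The inverse of the code map is order preserving. -/
theorem bruhatLE_of_code_le (hn : 2 ≤ n) {a a' : ℕ → ℕ} {b b' : ℕ} (h' : IsCode n a' b')
    (hle : ∀ i, 1 ≤ i → i ≤ n - 1 → a i ≤ a' i) (hb : b ≤ b') :
    cs.BruhatLE (prodX cs a (n - 1) * yElt cs b) (prodX cs a' (n - 1) * yElt cs b') := by
  -- Induction on the difference of the sums: each step raises a single entry of the smaller code by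
  -- one.
  obtain ⟨d, hd⟩ : ∃ d, ∑ i ∈ Finset.range (n - 1), a' (i + 1) + b' =
      ∑ i ∈ Finset.range (n - 1), a (i + 1) + b + d := by
    refine ⟨_, (Nat.add_sub_of_le (add_le_add (Finset.sum_le_sum fun i hi ↦ ?_) hb)).symm⟩
    exact hle _ (by omega) (by have := Finset.mem_range.1 hi; omega)
  induction d generalizing a b with
  | zero =>
    have hs : ∑ i ∈ Finset.range (n - 1), a (i + 1) ≤ ∑ i ∈ Finset.range (n - 1), a' (i + 1) :=
      Finset.sum_le_sum fun i hi ↦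
        hle _ (by omega) (by have := Finset.mem_range.1 hi; omega)
    have hs' := (Finset.sum_eq_sum_iff_of_le fun i hi ↦
        hle (i + 1) (by omega) (by have := Finset.mem_range.1 hi; omega)).1
      (show ∑ i ∈ Finset.range (n - 1), a (i + 1) = ∑ i ∈ Finset.range (n - 1), a' (i + 1) by
        omega)
    rw [show b = b' by omega, prodX_congr cs (a := a) (a' := a') fun i h1 h2 ↦ by
      have := hs' (i - 1) (Finset.mem_range.2 (by omega))
      rwa [show i - 1 + 1 = i by omega] at this]
    exact Relation.ReflTransGen.refl
  | succ d ih =>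
    have hc : IsCode n a b :=
      ⟨fun i h1 h2 ↦ by have := hle i h1 h2; have := h'.1 i h1 h2; omega, hb.trans h'.2⟩
    have hl := length_prodX_mul_yElt cs hn hc
    rcases hb.lt_or_eq with hlt | rfl
    · refine Relation.ReflTransGen.head ?_ (ih (b := b + 1) hle hlt (by omega))
      refine ((isInsertion_yElt cs (by have := h'.2; omega)).mul_left _).bruhatStep ?_
      have := length_prodX_mul_yElt cs hn (a := a) (b := b + 1) ⟨hc.1, by have := h'.2; omega⟩
      omega
    · obtain ⟨i, hi1, hi2, hi⟩ : ∃ i, 1 ≤ i ∧ i ≤ n - 1 ∧ a i < a' i := by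
        by_contra! hcon
        have := Finset.sum_le_sum (s := Finset.range (n - 1)) fun i hi ↦
          hcon (i + 1) (by omega) (by have := Finset.mem_range.1 hi; omega)
        omega
      have hle' : ∀ k, 1 ≤ k → k ≤ n - 1 → Function.update a i (a i + 1) k ≤ a' k := by
        intro k h1 h2
        by_cases h : k = i
        · subst h; rwa [Function.update_self]
        · rw [Function.update_of_ne h]; exact hle k h1 h2
      have hs := sum_update_succ a hi1 hi2
      have hai := h'.1 i hi1 hi2
      refine Relation.ReflTransGen.head ?_ (ih hle' le_rfl (by omega))
      refine ((isInsertion_prodX cs (by omega) hi1 hi2 (by omega)).mul_right _).bruhatStep ?_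
      have := length_prodX_mul_yElt cs hn (a := Function.update a i (a i + 1)) (b := b)
        ⟨fun k h1 h2 ↦ (Nat.succ_le_succ (hle' k h1 h2)).trans (h'.1 k h1 h2), h'.2⟩
      omega

theorem bruhatLE_xElt {i a a' : ℕ} (hi : 1 ≤ i) (hin : i < n) (h : a ≤ a')
    (ha : a' + 1 ≤ 2 * i) : cs.BruhatLE (xElt cs i a) (xElt cs i a') := by
  have := bruhatLE_of_code_le cs (by omega) (a := Pi.single i a) (isCode_single (n := n) ha)
    (fun k _ _ ↦ Pi.single_mono i h k) le_rfl
  rwa [prodX_single cs a hi (by omega), prodX_single cs a' hi (by omega), yElt, mul_one,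
    mul_one] at this

theorem bruhatLE_yElt (hn : 2 ≤ n) {b b' : ℕ} (h : b ≤ b') (hb : b' ≤ n - 1) :
    cs.BruhatLE (yElt cs b) (yElt cs b') := by
  have := bruhatLE_of_code_le cs hn (isCode_zero hb) (fun _ _ _ ↦ le_rfl) h
  simpa [prodX_zero] using this

end TypeD

/-! ### A length criterion for saturated chains. -/

namespace CoxeterSystem

variable {B W : Type*} [Group W] {M : CoxeterMatrix B} {cs : CoxeterSystem M W}

theorem BruhatLE.length_le {u v : W} (h : cs.BruhatLE u v) : cs.length u ≤ cs.length v := by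
  induction h with
  | refl => rfl
  | tail _ h ih =>
    obtain ⟨_, _, _, h⟩ := h
    omega

theorem BruhatLE.eq_of_length_le {u v : W} (h : cs.BruhatLE u v)
    (hl : cs.length v ≤ cs.length u) : u = v := by
  rcases Relation.ReflTransGen.cases_tail h with h | ⟨z, h1, _, _, _, h2⟩
  · exact h.symm
  · have := BruhatLE.length_le (cs := cs) h1
    omega

theorem BruhatLT.length_lt {u v : W} (h : cs.BruhatLT u v) : cs.length u < cs.length v := by
  by_contra! hl
  exact h.2 (h.1.eq_of_length_le hl)

/-- A sequence that increases in the Bruhat order by one length unit per step is a saturated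
chain. -/
theorem isSaturatedChain_of_length {C : Set W} {N : ℕ} {f : ℕ → W}
    (hC : ∀ w, w ∈ C ↔ ∃ a ≤ N, w = f a) (hl : ∀ a ≤ N, cs.length (f a) = a)
    (hf : ∀ a a', a ≤ a' → a' ≤ N → cs.BruhatLE (f a) (f a')) : cs.IsSaturatedChain C where
  finite := ((Set.finite_Iic N).image f).subset fun w hw ↦ by
    obtain ⟨a, ha, rfl⟩ := (hC w).1 hw
    exact ⟨a, ha, rfl⟩
  chain u hu v hv _ := by
    obtain ⟨a, ha, rfl⟩ := (hC u).1 hu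
    obtain ⟨b, hb, rfl⟩ := (hC v).1 hv
    rcases le_total a b with h | h
    · exact .inl (hf a b h hb)
    · exact .inr (hf b a h ha)
  saturated u hu v hv huv hbetween := by
    refine ⟨huv, fun z ⟨h1, h2⟩ ↦ ?_⟩
    obtain ⟨a, ha, rfl⟩ := (hC u).1 hu
    obtain ⟨b, hb, rfl⟩ := (hC v).1 hv
    have h3 := h1.length_lt
    have h4 := h2.length_lt
    have la := hl a ha
    have lb := hl b hb
    have lc := hl (a + 1) (by omega)
    -- An element of the group strictly between `f a` and `f b` forces `a + 2 ≤ b`, so `f (a + 1)`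
    -- already separates them within `C`.
    refine hbetween (f (a + 1)) ((hC _).2 ⟨a + 1, by omega, rfl⟩) ⟨⟨hf _ _ (by omega) (by omega),
      fun h ↦ ?_⟩, hf _ _ (by omega) hb, fun h ↦ ?_⟩
    · have := congrArg cs.length h
      omega
    · have := congrArg cs.length h
      omega

end CoxeterSystem

namespace TypeD

variable {n : ℕ} {W : Type*} [Group W] (cs : CoxeterSystem (coxeterMatrixD n) W)

/-! ### Identification of the chains with `xElt` and `yElt`. -/

theorem down_succ {a b : ℕ} (h : a ≤ b) : down cs b a = down cs b (a + 1) * gen cs a := by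
  rw [down, down, show b + 1 - a = b + 1 - (a + 1) + 1 by omega, List.range'_succ]
  simp

theorem down_eq_desc {m c : ℕ} (h : c ≤ m) : down cs m (m + 1 - c) = desc cs m c := by
  induction c with
  | zero => simp [down, desc]
  | succ c ih =>
    rw [desc, ← ih (by omega), down_succ cs (by omega), show m + 1 - (c + 1) + 1 = m + 1 - c by omega,
      show m + 1 - (c + 1) = m - c by omega]

theorem up_succ {a b : ℕ} (h : a ≤ b + 1) : up cs a (b + 1) = up cs a b * gen cs (b + 1) := by
  rw [up, up, show b + 1 + 1 - a = b + 1 - a + 1 by omega, List.range'_1_concat,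
    show a + (b + 1 - a) = b + 1 by omega]
  simp

theorem up_of_lt {a b : ℕ} (h : b < a) : up cs a b = 1 := by
  rw [up, show b + 1 - a = 0 by omega]; simp

theorem gen_zero_mul_up {k : ℕ} (hk : 1 ≤ k) : gen cs 0 * up cs 2 k = yElt cs k := by
  induction k, hk using Nat.le_induction with
  | base => rw [up_of_lt cs (by omega), yElt_one, mul_one]
  | succ k hk ih => rw [up_succ cs (by omega), ← mul_assoc, ih, yElt_succ cs hk]

/-- `s_0` commutes to the front of `s_i ⋯ s_3`, and each trailing letter `s_j`, `3 ≤ j ≤ k`, shifts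
through `s_i ⋯ s_1` to become `s_{j-1}`. -/
theorem down_mul_up_eq {i k : ℕ} (hi : i < n) (hk : 2 ≤ k) (hki : k ≤ i) :
    down cs i 3 * gen cs 0 * gen cs 2 * gen cs 1 * up cs 3 k =
      yElt cs (k - 1) * desc cs i i := by
  induction k, hk using Nat.le_induction with
  | base =>
    obtain ⟨i, rfl⟩ : ∃ c, i = c + 2 := ⟨i - 2, by omega⟩
    have h := down_eq_desc cs (m := i + 2) (c := i) (by omega)
    rw [show i + 2 + 1 - i = 3 by omega] at h
    rw [up_of_lt cs (by omega), h, desc_mul_gen_zero cs le_rfl, mul_one, yElt_one, desc, desc,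
      show i + 2 - i = 2 by omega, show i + 2 - (i + 1) = 1 by omega]
    simp only [mul_assoc]
  | succ k hk ih =>
    obtain ⟨k, rfl⟩ : ∃ c, k = c + 1 := ⟨k - 1, by omega⟩
    rw [up_succ cs (by omega), ← mul_assoc, ih (by omega), mul_assoc,
      desc_mul_gen_shift cs hi le_rfl (by omega) (by omega), ← mul_assoc]
    simp only [Nat.add_sub_cancel]
    rw [yElt_succ cs (by omega)]

theorem mem_chainY_iff (w : W) : w ∈ chainY cs ↔ ∃ b ≤ n - 1, w = yElt cs b := by
  constructor
  · rintro (rfl | ⟨k, hk, hkn, rfl⟩)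
    · exact ⟨0, Nat.zero_le _, rfl⟩
    · exact ⟨k, hkn, gen_zero_mul_up cs hk⟩
  · rintro ⟨b, hb, rfl⟩
    rcases Nat.eq_zero_or_pos b with rfl | hb0
    · exact .inl rfl
    · exact .inr ⟨b, hb0, hb, (gen_zero_mul_up cs hb0).symm⟩

theorem gen_mem_parabolic {J : Set (Fin n)} {k : ℕ} (hk : k < n) (h : ⟨k, hk⟩ ∈ J) :
    gen cs k ∈ cs.parabolic J := by
  rw [gen, dif_pos hk]
  exact Subgroup.subset_closure ⟨_, h, rfl⟩

theorem desc_mem_parabolic {i a : ℕ} (hi : i < n) (ha : a ≤ i) :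
    desc cs i a ∈ cs.parabolic {j : Fin n | 1 ≤ (j : ℕ) ∧ (j : ℕ) ≤ i} := by
  induction a with
  | zero => exact one_mem _
  | succ a ih =>
    refine mul_mem (ih (by omega)) (gen_mem_parabolic cs (by omega) ?_)
    simp only [Set.mem_ofPred_eq]; omega

/-- The type `A` analogue of the closure argument: for `s_1, …, s_m` alone the descending words
suffice as coset representatives. -/
theorem exists_prodX_mul_gen {m k : ℕ} {a : ℕ → ℕ} (hm : m < n)
    (ha : ∀ i, 1 ≤ i → i ≤ m → a i ≤ i) (hk : 1 ≤ k) (hkm : k ≤ m) :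
    ∃ a' : ℕ → ℕ, (∀ i, 1 ≤ i → i ≤ m → a' i ≤ i) ∧
      prodX cs a m * gen cs k = prodX cs a' m := by
  induction m generalizing k with
  | zero => omega
  | succ m ih =>
    have hA := ha (m + 1) (by omega) le_rfl
    have key : ∀ (a' : ℕ → ℕ) (A : ℕ), (∀ i, 1 ≤ i → i ≤ m → a' i ≤ i) → A ≤ m + 1 →
        ∃ a'' : ℕ → ℕ, (∀ i, 1 ≤ i → i ≤ m + 1 → a'' i ≤ i) ∧
          prodX cs a' m * desc cs (m + 1) A = prodX cs a'' (m + 1) := by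
      intro a' A ha' hA
      have hcongr : ∀ i, i ≤ m → Function.update a' (m + 1) A i = a' i := fun i hi ↦
        Function.update_of_ne (by omega) _ _
      refine ⟨Function.update a' (m + 1) A, fun i hi1 hi2 ↦ ?_, ?_⟩
      · rcases hi2.lt_or_eq with hi | rfl
        · rw [hcongr i (by omega)]; exact ha' i hi1 (by omega)
        · rwa [Function.update_self]
      · rw [prodX, Function.update_self, prodX_congr cs fun i _ hi ↦ hcongr i hi,
          xElt_eq_desc cs hA]
    have ha1 : ∀ i, 1 ≤ i → i ≤ m → a i ≤ i := fun i h1 h2 ↦ ha i h1 (by omega)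
    rw [prodX, xElt_eq_desc cs hA, mul_assoc]
    rcases desc_mul_gen_cases cs hm hA hk hkm with ⟨A, hA', -, h⟩ | ⟨k', h1, h2, h⟩
    · rw [h]; exact key a A ha1 hA'
    · obtain ⟨a', ha', h'⟩ := ih (by omega) ha1 h1 (by omega)
      rw [h, ← mul_assoc, h']
      exact key a' _ ha' hA

theorem exists_prodX_of_mem_parabolic {i : ℕ} (hi : i < n) {w : W}
    (hw : w ∈ cs.parabolic {j : Fin n | 1 ≤ (j : ℕ) ∧ (j : ℕ) ≤ i}) :
    ∃ a : ℕ → ℕ, (∀ k, 1 ≤ k → k ≤ i → a k ≤ k) ∧ w = prodX cs a i := by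
  have step : ∀ (x : W) (j : Fin n), 1 ≤ (j : ℕ) ∧ (j : ℕ) ≤ i →
      (∃ a : ℕ → ℕ, (∀ k, 1 ≤ k → k ≤ i → a k ≤ k) ∧ x = prodX cs a i) →
      ∃ a : ℕ → ℕ, (∀ k, 1 ≤ k → k ≤ i → a k ≤ k) ∧ x * cs.simple j = prodX cs a i := by
    rintro x j ⟨h1, h2⟩ ⟨a, ha, rfl⟩
    obtain ⟨a', ha', h⟩ := exists_prodX_mul_gen cs hi ha h1 h2
    exact ⟨a', ha', by rw [← h, gen, dif_pos j.2]⟩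
  induction hw using Subgroup.closure_induction_right with
  | one => exact ⟨0, fun _ _ _ ↦ Nat.zero_le _, (prodX_zero cs i).symm⟩
  | mul_right x y hy s ih =>
    obtain ⟨j, hj, rfl⟩ := s
    exact step x j hj ih
  | mul_inv_cancel x y hy s ih =>
    obtain ⟨j, hj, rfl⟩ := s
    rw [cs.inv_simple]
    exact step x j hj ih

theorem desc_succ_eq_gen_mul (m a : ℕ) :
    ∃ u, desc cs m (a + 1) = gen cs m * u ∧ cs.length u ≤ a := by
  induction a with
  | zero => exact ⟨1, by simp [desc], by simp⟩
  | succ a ih =>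
    obtain ⟨u, h, hu⟩ := ih
    exact ⟨u * gen cs (m - (a + 1)), by rw [desc, h, mul_assoc],
      length_mul_le_of_le cs hu (length_gen_le cs _)⟩

/-- The first nontrivial factor begins with `s_j`. Since lengths add, this makes `s_j` a left
descent of the product. -/
theorem prodX_eq_gen_mul {a : ℕ → ℕ} {j m : ℕ} (hj : 1 ≤ j) (hjm : j ≤ m) (haj : a j ≤ j)
    (h0 : ∀ k, 1 ≤ k → k < j → a k = 0) (h : a j ≠ 0) :
    ∃ u, prodX cs a m = gen cs j * u ∧
      cs.length u + 1 ≤ ∑ k ∈ Finset.range m, a (k + 1) := by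
  induction m, hjm using Nat.le_induction with
  | base =>
    obtain ⟨c, hc⟩ : ∃ c, a j = c + 1 := ⟨a j - 1, by omega⟩
    obtain ⟨u, hu, hl⟩ := desc_succ_eq_gen_mul cs j c
    refine ⟨u, ?_, ?_⟩
    · rw [prodX_eq_xElt cs hj le_rfl fun k h1 h2 h3 ↦ h0 k h1 (by omega), xElt_eq_desc cs haj, hc,
        hu]
    · have := Finset.single_le_sum (f := fun k ↦ a (k + 1)) (fun _ _ ↦ Nat.zero_le _)
        (Finset.mem_range.2 (show j - 1 < j by omega))
      simp only [show j - 1 + 1 = j by omega] at this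
      omega
  | succ m hm ih =>
    obtain ⟨u, hu, hl⟩ := ih
    refine ⟨u * xElt cs (m + 1) (a (m + 1)), by rw [prodX, hu, mul_assoc], ?_⟩
    have := length_mul_le_of_le cs le_rfl (length_xElt_le cs (m + 1) (a (m + 1))) (u := u)
    rw [Finset.sum_range_succ]
    omega

theorem length_prodX {i : ℕ} {a : ℕ → ℕ} (hi : i < n)
    (ha : ∀ k, 1 ≤ k → k ≤ i → a k + 1 ≤ 2 * k) :
    cs.length (prodX cs a i) = ∑ k ∈ Finset.range i, a (k + 1) := by
  rcases Nat.eq_zero_or_pos i with rfl | hi0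
  · simp [prodX]
  set c : ℕ → ℕ := fun k ↦ if k ≤ i then a k else 0 with hc
  have hcode : IsCode n c 0 := by
    refine ⟨fun k h1 _ ↦ ?_, Nat.zero_le _⟩
    simp only [hc]
    split_ifs with h
    · exact ha k h1 h
    · omega
  have hca : ∀ k, k ≤ i → c k = a k := fun k hk ↦ if_pos hk
  have := length_prodX_mul_yElt cs (by omega) hcode
  rw [yElt, mul_one, add_zero, prodX_eq_of_zero cs (by omega : i ≤ n - 1) fun k h1 _ ↦
    if_neg (by omega), prodX_congr cs fun k _ h ↦ hca k h] at this
  rw [this]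
  refine (Finset.sum_subset (Finset.range_subset_range.2 (by omega)) fun k _ hk ↦ ?_).symm.trans
    (Finset.sum_congr rfl fun k hk ↦ hca _ ?_)
  · exact if_neg (by simpa using hk)
  · have := Finset.mem_range.1 hk; omega

/-- In the type `A` normal form a nonzero entry before the last yields a left descent `s_j` with `j
< i`, so quotient elements consist of the last factor only. -/
theorem mem_leftQuotient_iff {i : ℕ} (hi : 1 ≤ i) (hin : i < n) (w : W) :
    w ∈ cs.leftQuotient {j : Fin n | 1 ≤ (j : ℕ) ∧ (j : ℕ) ≤ i - 1}
        {j : Fin n | 1 ≤ (j : ℕ) ∧ (j : ℕ) ≤ i} ↔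
      ∃ a ≤ i, w = desc cs i a := by
  constructor
  · rintro ⟨hw, hq⟩
    obtain ⟨a, ha, rfl⟩ := exists_prodX_of_mem_parabolic cs hin hw
    have hlen := length_prodX cs hin (a := a) fun k h1 h2 ↦ by have := ha k h1 h2; omega
    have hz : ∀ j, 1 ≤ j → j ≤ i → j ≠ i → a j = 0 := by
      intro j
      induction j using Nat.strong_induction_on with
      | _ j ih =>
        intro h1 h2 h3
        by_contra hne
        obtain ⟨u, hu, hl⟩ := prodX_eq_gen_mul cs h1 h2 (ha j h1 h2)
          (fun k hk1 hk2 ↦ ih k hk2 hk1 (by omega) (by omega)) hne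
        have := hq ⟨j, by omega⟩ ⟨h1, by simp only; omega⟩
        rw [← hlen, hu] at hl
        rw [hu, gen, dif_pos (by omega), cs.simple_mul_simple_cancel_left] at this
        rw [gen, dif_pos (by omega)] at hl
        omega
    exact ⟨a i, ha i hi le_rfl, by rw [prodX_eq_xElt cs hi le_rfl hz, xElt_eq_desc cs (ha i hi le_rfl)]⟩
  · rintro ⟨a, ha, rfl⟩
    refine ⟨desc_mem_parabolic cs hin ha, fun j ⟨h1, h2⟩ ↦ ?_⟩
    have hji : (j : ℕ) ≠ i := by omega
    -- For `j < i` the product of `s_j` with the descending word is itself in normal form, with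
    -- `s_j` as the length-one element of `X_j`; its length is therefore at least `a + 1`.
    set c : ℕ → ℕ := Function.update (Pi.single i a) j 1 with hc
    have hcj : c j = 1 := Function.update_self ..
    have hci : c i = a := by
      rw [hc, Function.update_of_ne hji.symm, Pi.single_eq_same]
    have hc0 : ∀ k, k ≠ i → k ≠ j → c k = 0 := fun k h h' ↦ by
      rw [hc, Function.update_of_ne h', Pi.single_eq_of_ne h]
    obtain ⟨i, rfl⟩ : ∃ m, i = m + 1 := ⟨i - 1, by omega⟩
    have hcode : ∀ k, 1 ≤ k → k ≤ i + 1 → c k + 1 ≤ 2 * k := fun k h _ ↦ by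
      by_cases hk : k = i + 1
      · subst hk; omega
      by_cases hk' : k = j
      · subst hk'; omega
      · rw [hc0 k hk hk']; omega
    have hprod : prodX cs c (i + 1) = cs.simple j * desc cs (i + 1) a := by
      rw [prodX, prodX_eq_xElt cs h1 (by omega) fun k _ h h' ↦ hc0 k (by omega) h', hcj, hci,
        xElt_eq_desc cs h1, xElt_eq_desc cs ha]
      simp [desc, gen]
    have hsum : a + 1 ≤ ∑ k ∈ Finset.range (i + 1), c (k + 1) := by
      have := Finset.single_le_sum (f := fun k ↦ c (k + 1)) (fun _ _ ↦ Nat.zero_le _)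
        (Finset.mem_range.2 (show (j : ℕ) - 1 < i by omega))
      simp only [show (j : ℕ) - 1 + 1 = j by omega, hcj] at this
      rw [Finset.sum_range_succ, hci]
      omega
    have := length_prodX cs hin hcode
    have hd := length_desc_le cs (i + 1) a
    rw [← hprod]
    omega

theorem mem_chainX_iff {i : ℕ} (hi : 1 ≤ i) (hin : i < n) (w : W) :
    w ∈ chainX cs i ↔ ∃ a ≤ 2 * i - 1, w = xElt cs i a := by
  rw [chainX, Set.mem_union, mem_leftQuotient_iff cs hi hin]
  constructor
  · rintro (⟨a, ha, rfl⟩ | ⟨k, hk, hki, rfl⟩)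
    · exact ⟨a, by omega, (xElt_eq_desc cs ha).symm⟩
    · refine ⟨i + (k - 1), by omega, ?_⟩
      rw [down_mul_up_eq cs hin hk hki, xElt, if_neg (by omega), Nat.add_sub_cancel_left]
  · rintro ⟨a, ha, rfl⟩
    by_cases h : a ≤ i
    · exact .inl ⟨a, h, xElt_eq_desc cs h⟩
    · refine .inr ⟨a - i + 1, by omega, by omega, ?_⟩
      rw [down_mul_up_eq cs hin (by omega) (by omega), xElt, if_neg (by omega),
        Nat.add_sub_cancel]

theorem isSaturatedChain_chainX {i : ℕ} (hi : 1 ≤ i) (hin : i < n) :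
    cs.IsSaturatedChain (chainX cs i) :=
  CoxeterSystem.isSaturatedChain_of_length (mem_chainX_iff cs hi hin)
    (fun a ha ↦ length_xElt cs hi hin (by omega))
    fun a a' h ha ↦ bruhatLE_xElt cs hi hin h (by omega)

theorem isSaturatedChain_chainY (hn : 2 ≤ n) : cs.IsSaturatedChain (chainY cs) :=
  CoxeterSystem.isSaturatedChain_of_length (mem_chainY_iff cs)
    (fun _ hb ↦ length_yElt cs hn hb) fun _ _ h hb ↦ bruhatLE_yElt cs hn h hb

/-! ### Codes as tuples, and the exponents. -/

/-- The entries `a_1, …, a_{n-1}` of a code, as a function on `ℕ`. -/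
def codeX (c : Fin (n - 1) ⊕ Unit → ℕ) (k : ℕ) : ℕ :=
  if h : k - 1 < n - 1 then c (.inl ⟨k - 1, h⟩) else 0

/-- The element `x_1 ⋯ x_{n-1} y` with the given lengths of the factors. -/
def evalCode (c : Fin (n - 1) ⊕ Unit → ℕ) : W :=
  prodX cs (codeX c) (n - 1) * yElt cs (c (.inr ()))

theorem codeX_succ (c : Fin (n - 1) ⊕ Unit → ℕ) (i : Fin (n - 1)) :
    codeX c (i + 1) = c (.inl i) := by
  simp [codeX]

theorem codeX_elim (a : ℕ → ℕ) (b : ℕ) {k : ℕ} (h1 : 1 ≤ k) (hk : k ≤ n - 1) :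
    codeX (n := n) (Sum.elim (fun i ↦ a ((i : ℕ) + 1)) fun _ ↦ b) k = a k := by
  rw [codeX, dif_pos (by omega)]
  simp only [Sum.elim_inl]
  rw [Nat.sub_add_cancel h1]

theorem le_exponents_iff (c : Fin (n - 1) ⊕ Unit → ℕ) :
    c ≤ exponents n ↔ IsCode n (codeX c) (c (.inr ())) := by
  simp only [Pi.le_def, Sum.forall, exponents, Sum.elim_inl, Sum.elim_inr, IsCode]
  refine and_congr ⟨fun h i h1 h2 ↦ ?_, fun h i ↦ ?_⟩ ⟨fun h ↦ h (), fun h _ ↦ h⟩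
  · rw [codeX, dif_pos (by omega)]
    have := h ⟨i - 1, by omega⟩
    simp only at this
    omega
  · have := h (i + 1) (by omega) (by omega)
    rw [codeX_succ] at this
    omega

theorem sum_code (c : Fin (n - 1) ⊕ Unit → ℕ) :
    ∑ i, c i = ∑ k ∈ Finset.range (n - 1), codeX c (k + 1) + c (.inr ()) := by
  simp [Finset.sum_range, codeX_succ]

theorem length_evalCode (hn : 2 ≤ n) {c : Fin (n - 1) ⊕ Unit → ℕ} (hc : c ≤ exponents n) :
    cs.length (evalCode cs c) = ∑ i, c i := by
  rw [sum_code]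
  exact length_prodX_mul_yElt cs hn ((le_exponents_iff c).1 hc)

theorem evalCode_bijOn (hn : 2 ≤ n) :
    Set.BijOn (evalCode cs) (Set.Iic (exponents n)) Set.univ := by
  refine ⟨Set.mapsTo_univ _ _, fun c hc c' hc' h ↦ ?_, fun w _ ↦ ?_⟩
  · have hcode := (le_exponents_iff c).1 hc
    have hcode' := (le_exponents_iff c').1 hc'
    obtain ⟨h1, h2⟩ := prodX_mul_yElt_injective cs (by omega) hcode.1 hcode'.1 hcode.2 hcode'.2 h
    ext (i | i)
    · simpa only [codeX_succ] using h1 (i + 1) (by omega) (by omega)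
    · exact h2
  · obtain ⟨a, b, h, -, rfl⟩ := exists_code cs hn w
    have heq := fun k h1 hk ↦ codeX_elim (n := n) a b (k := k) h1 hk
    refine ⟨Sum.elim (fun i ↦ a (i + 1)) fun _ ↦ b, (le_exponents_iff _).2 ⟨fun i h1 h2 ↦ ?_, h.2⟩, ?_⟩
    · rw [heq i h1 h2]; exact h.1 i h1 h2
    · rw [evalCode, prodX_congr cs heq, Sum.elim_inr]

theorem prod_ofFn_xElt (a : ℕ → ℕ) (m : ℕ) :
    (List.ofFn fun i : Fin m ↦ xElt cs (i + 1) (a (i + 1))).prod = prodX cs a m := by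
  induction m with
  | zero => rfl
  | succ m ih =>
    rw [List.ofFn_succ_last, List.prod_append, List.prod_singleton, prodX]
    simp only [Fin.val_castSucc, Fin.val_last, ih]

theorem isFactorization_iff (w : W) (x : Fin (n - 1) → W) (y : W) :
    IsFactorization cs w x y ↔ ∃ c ≤ exponents n, (∀ i, x i = xElt cs (i + 1) (c (.inl i))) ∧
      y = yElt cs (c (.inr ())) ∧ evalCode cs c = w := by
  have hprod : ∀ c : Fin (n - 1) ⊕ Unit → ℕ, (∀ i, x i = xElt cs (i + 1) (c (.inl i))) →
      (List.ofFn x).prod = prodX cs (codeX c) (n - 1) := fun c hc ↦ by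
    rw [← prod_ofFn_xElt]
    congr 2
    funext i
    rw [hc, codeX_succ]
  constructor
  · rintro ⟨hx, hy, rfl⟩
    choose a ha hxa using fun i ↦ (mem_chainX_iff cs (by omega) (by omega) _).1 (hx i)
    obtain ⟨b, hb, rfl⟩ := (mem_chainY_iff cs y).1 hy
    refine ⟨Sum.elim a fun _ ↦ b, ?_, hxa, rfl, ?_⟩
    · rintro (i | i)
      · exact ha i
      · exact hb
    · rw [evalCode, ← hprod _ hxa]; rfl
  · rintro ⟨c, hc, hx, rfl, rfl⟩
    refine ⟨fun i ↦ ?_, (mem_chainY_iff cs _).2 ⟨_, hc (.inr ()), rfl⟩, by rw [hprod c hx]; rfl⟩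
    exact (mem_chainX_iff cs (by omega) (by omega) _).2 ⟨_, hc (.inl i), hx i⟩

/-- Expanding the product gives one monomial per code, whose degree is the sum of the code and hence
the length of the corresponding element. -/
theorem isExponents (hn : 2 ≤ n) : cs.IsExponents (exponents n) := by
  have hbij := evalCode_bijOn cs hn
  have hfin : Finite W := Set.finite_univ_iff.1 (hbij.image_eq ▸ (Set.finite_Iic _).image _)
  refine ⟨hfin, ?_, ?_, ?_⟩
  · rw [Nat.card_eq_fintype_card, Nat.card_eq_fintype_card]
    simp only [Fintype.card_sum, Fintype.card_fin, Fintype.card_unit]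
    omega
  · rintro (i | i) <;> simp only [exponents, Sum.elim_inl, Sum.elim_inr] <;> omega
  · have := Fintype.ofFinite W
    have hmem : ∀ c, c ∈ Fintype.piFinset (fun i ↦ Finset.range (exponents n i + 1)) ↔
        c ≤ exponents n := fun c ↦ by
      simp [Fintype.mem_piFinset, Pi.le_def]
    rw [finsum_eq_sum_of_fintype, Finset.prod_univ_sum]
    symm
    refine Finset.sum_nbij (evalCode cs) (fun _ _ ↦ Finset.mem_univ _) ?_ ?_ fun c hc ↦ ?_
    · exact fun c hc c' hc' h ↦ hbij.injOn ((hmem c).1 hc) ((hmem c').1 hc') h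
    · intro w _
      obtain ⟨c, hc, rfl⟩ := hbij.surjOn (Set.mem_univ w)
      exact ⟨c, (hmem c).2 hc, rfl⟩
    · rw [length_evalCode cs hn ((hmem c).1 hc), Finset.prod_pow_eq_pow_sum]

end TypeD

theorem mainTheorem9 {n : ℕ} (hn : 4 ≤ n) {W : Type*} [Group W]
    (cs : CoxeterSystem (coxeterMatrixD n) W) :
    (∀ i : ℕ, 1 ≤ i → i ≤ n - 1 → cs.IsSaturatedChain (TypeD.chainX cs i)) ∧
    cs.IsSaturatedChain (TypeD.chainY cs) ∧
    ∃ (x : W → Fin (n - 1) → W) (y : W → W),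
      (∀ w : W, TypeD.IsFactorization cs w (x w) (y w)) ∧
      (∀ (w : W) (x' : Fin (n - 1) → W) (y' : W),
        TypeD.IsFactorization cs w x' y' → x' = x w ∧ y' = y w) ∧
      cs.IsLehmerCode (TypeD.exponents n) (fun w ↦ TypeD.lengths cs (x w) (y w)) := by
  have hn2 : 2 ≤ n := by omega
  refine ⟨fun i h1 h2 ↦ TypeD.isSaturatedChain_chainX cs h1 (by omega),
    TypeD.isSaturatedChain_chainY cs hn2, ?_⟩
  have hbij := TypeD.evalCode_bijOn cs hn2
  choose code hle hcode using fun w ↦ hbij.surjOn (Set.mem_univ w)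
  have hlengths : ∀ w, TypeD.lengths cs (fun i : Fin (n - 1) ↦
      TypeD.xElt cs (i + 1) (code w (.inl i))) (TypeD.yElt cs (code w (.inr ()))) = code w := by
    intro w
    ext (i | i)
    · have := hle w (.inl i)
      simp only [TypeD.exponents, Sum.elim_inl] at this
      exact TypeD.length_xElt cs (by omega) (by omega) (by omega)
    · exact TypeD.length_yElt cs hn2 (hle w (.inr ()))
  refine ⟨fun w i ↦ TypeD.xElt cs (i + 1) (code w (.inl i)),
    fun w ↦ TypeD.yElt cs (code w (.inr ())), fun w ↦ ?_, fun w x' y' h ↦ ?_, ?_⟩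
  · exact (TypeD.isFactorization_iff cs _ _ _).2 ⟨code w, hle w, fun _ ↦ rfl, rfl, hcode w⟩
  · obtain ⟨c, hc, hx, hy, h'⟩ := (TypeD.isFactorization_iff cs _ _ _).1 h
    obtain rfl : c = code w := hbij.injOn hc (hle w) (h'.trans (hcode w).symm)
    exact ⟨funext hx, hy⟩
  · simp only [hlengths]
    refine ⟨TypeD.isExponents cs hn2, ⟨fun w _ ↦ hle w, fun u _ v _ h ↦ ?_, fun c hc ↦ ?_⟩,
      fun u v h ↦ ?_⟩
    · rw [← hcode u, ← hcode v, show code u = code v from h]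
    · exact ⟨TypeD.evalCode cs c, Set.mem_univ _, hbij.injOn (hle _) hc (hcode _)⟩
    · rw [← hcode u, ← hcode v]
      refine TypeD.bruhatLE_of_code_le cs hn2 ((TypeD.le_exponents_iff _).1 (hle v))
        (fun i h1 h2 ↦ ?_) (h (.inr ()))
      simp only [TypeD.codeX]
      rw [dif_pos (by omega), dif_pos (by omega)]
      exact h (.inl _)
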